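/- Let $\Omega=[0,1]$ with Lebesgue measure $\mu$. For a metrizable space $X$ let $L^0(\Omega,X)$ be the space of measurable maps $\Omega\to X$ up to almost everywhere equality, with the topology of the distance $\int_\Omega d(r(\omega),s(\omega))\,d\mu$, where $d$ is any bounded compatible distance on $X$. Let $\mathrm{End}(\Omega)$ (resp. $\mathrm{Aut}(\Omega)$) be the monoid of measure-preserving (resp. the group of invertible measure-preserving) transformations of $\Omega$ up to almost everywhere equality; $\mathrm{Aut}(\Omega)$ acts on $L^0(\Omega,X)$ by $(tr)(\omega)=r(t^{-1}\omega)$ and carries the topology of pointwise convergence on $L^0(\Omega,[0,1])$. For a Polish group $G$, the group $L^0(\Omega,G)$ (pointwise multiplication) is a topological group on which $\mathrm{Aut}(\Omega)$ acts as above, and the measurable wreath product is $G\wr\Omega=L^0(\Omega,G)\rtimes\mathrm{Aut}(\Omega)$ with the product topology. A compactification of a topological group $H$ is a continuous action of $H$ on a compact Hausdorff space together with a distinguished point whose orbit is dense; an isomorphism of compactifications is an $H$-equivariant homeomorphism that respects the distinguished points. The Roelcke uniformity of $H$ is the infimum of its left and right uniformities (the finest uniformity coarser than both), and $R(H)$ denotes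 the completion of $H$ for it, with the action of $H$ extending left translation and with the image of $1_H$ as distinguished point; $H$ is Roelcke precompact if $R(H)$ is compact. For a compact metrizable space $K$, the Markov randomization $\mathcal M(\Omega,K)$ is the space of Borel probability measures on $\Omega\times K\times\Omega$ whose first and third marginals are both $\mu$, with the weak$^*$ topology. For $s,r\in\mathrm{End}(\Omega)$ and $k\in L^0(\Omega,K)$ let $[s,k,r]\in\mathcal M(\Omega,K)$ be the joint law of $(s,k,r)$. A continuous action of $G$ on $K$ induces the action of $G\wr\Omega$ on $\mathcal M(\Omega,K)$ in which $gt$, for $g\in L^0(\Omega,G)$ and $t\in\mathrm{Aut}(\Omega)$, maps a measure to its image under $(\omega_0,k,\omega_1)\mapsto(t\omega_0,\,g(t\omega_0)k,\,\omega_1)$; equivalently, $t[s,k,r]=[ts,k,r]$ and $g[s,k,r]=[s,k',r]$ with $k'(\omega)=g(s(\omega))k(\omega)$. **Theorem.** Let $G$ be a Roelcke precompact Polish group and let $k_0\in R(G)$ be its distinguished point. Then $R(G\wr\Omega)$ and $\mathcal M(\Omega,R(G))$, with distinguished point $[1,k_0,1]$ ($k_0$ seen as a constant random variable), are compactifications of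 $G\wr\Omega$, and they are isomorphic as such: there is a $G\wr\Omega$-equivariant homeomorphism $$R(G\wr\Omega)\simeq\mathcal M(\Omega,R(G))$$ that respects the distinguished points. -/

import Mathlib

namespace Randomization

noncomputable section

open MeasureTheory Filter Topology Set
open scoped ENNReal

/-- The atomless Lebesgue space: the unit interval with Lebesgue measure `volume`. -/
abbrev Ω : Type := unitInterval

/-- `X^Ω = L⁰(Ω, X)`: measurable maps `Ω → X` up to almost everywhere equality. -/
abbrev L0 (X : Type*) [TopologicalSpace X] : Type _ := Ω →ₘ[(volume : Measure Ω)] X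

namespace L0

/-- The `L¹`-distance on `L⁰(Ω, X)` associated with the bounded distance `min 1 d` of a metric
space `(X, d)`. -/
abbrev pseudoEMetricSpace (X : Type*) [MetricSpace X] : PseudoEMetricSpace (L0 X) where
  edist f g := ∫⁻ ω, min 1 (edist (f ω) (g ω))
  edist_self f := by simp
  edist_comm f g := by simp only [edist_comm]
  edist_triangle f g h := by
    have hm : Measurable fun ω => min 1 (edist (f ω) (g ω)) :=
      measurable_const.min (f.stronglyMeasurable.edist g.stronglyMeasurable).measurable
    rw [← lintegral_add_left hm]
    refine lintegral_mono fun ω => ?_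
    refine (min_le_min_left 1 (edist_triangle (f ω) (g ω) (h ω))).trans ?_
    rcases le_total 1 (edist (f ω) (g ω)) with h1 | h1
    · simp [h1]
    rcases le_total 1 (edist (g ω) (h ω)) with h2 | h2
    · simp [h2]
    · simp [h1, h2]

variable {X : Type*} [TopologicalSpace X]

/-- The topology of `L⁰(Ω, X)` for a metrizable space `X`: that of the `L¹`-distance of any
bounded compatible distance on `X`. -/
instance instTopologicalSpace [TopologicalSpace.MetrizableSpace X] : TopologicalSpace (L0 X) :=
  letI := TopologicalSpace.metrizableSpaceMetric X
  (pseudoEMetricSpace X).toUniformSpace.toTopologicalSpace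

theorem tendsto_iff_metric {X : Type*} [MetricSpace X] {f : ℕ → L0 X} {g : L0 X} :
    Tendsto f atTop (@nhds _ (pseudoEMetricSpace X).toUniformSpace.toTopologicalSpace g) ↔
      ∀ ns : ℕ → ℕ, StrictMono ns → ∃ ms : ℕ → ℕ, StrictMono ms ∧
        ∀ᵐ ω : Ω, Tendsto (fun i => f (ns (ms i)) ω) atTop (𝓝 (g ω)) := by
  have hmeas : ∀ n, Measurable fun ω => edist (f n ω) (g ω) := fun n =>
    ((f n).stronglyMeasurable.edist g.stronglyMeasurable).measurable
  rw [← exists_seq_tendstoInMeasure_atTop_iff (fun n => (f n).aestronglyMeasurable)]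
  let := pseudoEMetricSpace X
  rw [tendsto_iff_edist_tendsto_0]
  change Tendsto (fun n => ∫⁻ ω, min 1 (edist (f n ω) (g ω))) atTop (𝓝 0) ↔ _
  constructor
  · intro h ε hε
    have hε' : min 1 ε ≠ 0 := by positivity
    have hε'' : min 1 ε ≠ ⊤ := (lt_of_le_of_lt (min_le_left _ _) ENNReal.one_lt_top).ne
    have h2 := ENNReal.Tendsto.div_const h (Or.inr hε')
    rw [ENNReal.zero_div] at h2
    refine tendsto_of_tendsto_of_tendsto_of_le_of_le tendsto_const_nhds h2 (fun _ => zero_le)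
      (fun n => ?_)
    refine (measure_mono ?_).trans
      (meas_ge_le_lintegral_div (measurable_const.min (hmeas n)).aemeasurable hε' hε'')
    intro ω hω
    exact min_le_min_left 1 (show ε ≤ edist (f n ω) (g ω) from hω)
  · intro h
    apply tendsto_of_subseq_tendsto
    intro ns hns
    obtain ⟨ms, hms, hae⟩ := (h.comp hns).exists_seq_tendsto_ae
    refine ⟨ms, ?_⟩
    have := tendsto_lintegral_of_dominated_convergence (μ := (volume : Measure Ω))
      (F := fun n ω => min 1 (edist (f (ns (ms n)) ω) (g ω))) (f := fun _ => 0) (fun _ => 1)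
      (fun n => measurable_const.min (hmeas _)) (fun n => ae_of_all _ fun ω => min_le_left _ _)
      (by simp) ?_
    · simpa using this
    · filter_upwards [hae] with ω hω
      have h3 := tendsto_iff_edist_tendsto_0.1 hω
      have h4 := (tendsto_const_nhds (x := (1 : ℝ≥0∞))).min h3
      simpa using h4

/-- A sequence converges in `L⁰(Ω, X)` iff each subsequence has a further subsequence that
converges almost surely; in particular the topology does not depend on the distance chosen. -/
theorem tendsto_iff [TopologicalSpace.MetrizableSpace X] {f : ℕ → L0 X} {g : L0 X} :
    Tendsto f atTop (𝓝 g) ↔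
      ∀ ns : ℕ → ℕ, StrictMono ns → ∃ ms : ℕ → ℕ, StrictMono ms ∧
        ∀ᵐ ω : Ω, Tendsto (fun i => f (ns (ms i)) ω) atTop (𝓝 (g ω)) :=
  letI := TopologicalSpace.metrizableSpaceMetric X
  tendsto_iff_metric

end L0

/-- `End(Ω)`: measure-preserving transformations of `Ω` up to almost everywhere equality. -/
def EndΩ : Type := {s : L0 Ω // MeasurePreserving s (volume : Measure Ω) volume}

namespace EndΩ

theorem ext {s r : EndΩ} (h : ∀ᵐ ω : Ω, s.1 ω = r.1 ω) : s = r := Subtype.ext (AEEqFun.ext h)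

instance instMul : Mul EndΩ where
  mul s r := ⟨s.1.compMeasurePreserving r.1 r.2, (s.2.comp r.2).congr
    (AEEqFun.stronglyMeasurable _).measurable
    (AEEqFun.coeFn_compMeasurePreserving s.1 r.2).symm⟩

instance instOne : One EndΩ where
  one := ⟨AEEqFun.mk id aestronglyMeasurable_id, (MeasurePreserving.id _).congr
    (AEEqFun.stronglyMeasurable _).measurable (AEEqFun.coeFn_mk _ _).symm⟩

theorem mul_ae (s r : EndΩ) : ∀ᵐ ω : Ω, (s * r).1 ω = s.1 (r.1 ω) :=
  AEEqFun.coeFn_compMeasurePreserving s.1 r.2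

theorem one_ae : ∀ᵐ ω : Ω, (1 : EndΩ).1 ω = ω := AEEqFun.coeFn_mk _ _

/-- `End(Ω)` is a monoid under composition. -/
instance instMonoid : Monoid EndΩ where
  mul_assoc s r u := ext <| by
    filter_upwards [mul_ae (s * r) u, mul_ae s (r * u), mul_ae r u,
      u.2.quasiMeasurePreserving.ae (mul_ae s r)] with ω h1 h2 h3 h4
    rw [h1, h2, h3, h4]
  one_mul s := ext <| by
    filter_upwards [mul_ae 1 s, s.2.quasiMeasurePreserving.ae one_ae] with ω h1 h2
    rw [h1, h2]
  mul_one s := ext <| by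
    filter_upwards [mul_ae s 1, one_ae] with ω h1 h2
    rw [h1, h2]

end EndΩ

/-- `Aut(Ω)`: invertible measure-preserving transformations of `Ω` up to almost everywhere
equality, i.e. those having a measure-preserving inverse up to almost everywhere equality. -/
def AutΩ : Type := EndΩˣ

namespace AutΩ

instance instGroup : Group AutΩ := inferInstanceAs (Group EndΩˣ)

/-- A representative of an element of `Aut(Ω)` as a map `Ω → Ω`. -/
def toFun (t : AutΩ) : Ω → Ω := (Units.val t : EndΩ).1

theorem measurePreserving (t : AutΩ) : MeasurePreserving t.toFun (volume : Measure Ω) volume :=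
  (Units.val t : EndΩ).2

theorem mul_ae (t u : AutΩ) : ∀ᵐ ω : Ω, (t * u).toFun ω = t.toFun (u.toFun ω) :=
  EndΩ.mul_ae (Units.val t) (Units.val u)

theorem one_ae : ∀ᵐ ω : Ω, (1 : AutΩ).toFun ω = ω := EndΩ.one_ae

theorem inv_apply_ae (t : AutΩ) : ∀ᵐ ω : Ω, t⁻¹.toFun (t.toFun ω) = ω := by
  filter_upwards [mul_ae t⁻¹ t, one_ae] with ω h1 h2
  rw [← h1, inv_mul_cancel, h2]

variable {X : Type*} [TopologicalSpace X]

/-- The action of `Aut(Ω)` on `L⁰(Ω, X)`: `(t r)(ω) = r (t⁻¹ ω)`. -/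
def act (t : AutΩ) (r : L0 X) : L0 X := r.compMeasurePreserving t⁻¹.toFun t⁻¹.measurePreserving

theorem act_ae (t : AutΩ) (r : L0 X) : ∀ᵐ ω : Ω, t.act r ω = r (t⁻¹.toFun ω) :=
  AEEqFun.coeFn_compMeasurePreserving r t⁻¹.measurePreserving

theorem one_act (r : L0 X) : (1 : AutΩ).act r = r := AEEqFun.ext <| by
  filter_upwards [act_ae 1 r, one_ae] with ω h1 h2
  rw [h1, inv_one, h2]

theorem mul_act (t u : AutΩ) (r : L0 X) : (t * u).act r = t.act (u.act r) := AEEqFun.ext <| by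
  filter_upwards [act_ae (t * u) r, act_ae t (u.act r), mul_ae u⁻¹ t⁻¹,
    t⁻¹.measurePreserving.quasiMeasurePreserving.ae (act_ae u r)] with ω h1 h2 h3 h4
  rw [h1, h2, h4, mul_inv_rev, h3]

/-- `Aut(Ω)` carries the topology of pointwise convergence on `𝔸 = L⁰(Ω, [0,1])`. -/
instance instTopologicalSpace : TopologicalSpace AutΩ :=
  TopologicalSpace.induced (fun t (r : L0 unitInterval) => t.act r) Pi.topologicalSpace

theorem edist_act {X : Type*} [MetricSpace X] (t : AutΩ) (f g : L0 X) :
    (L0.pseudoEMetricSpace X).edist (t.act f) (t.act g) =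
      (L0.pseudoEMetricSpace X).edist f g := by
  change ∫⁻ ω, min 1 (edist (t.act f ω) (t.act g ω)) = ∫⁻ ω, min 1 (edist (f ω) (g ω))
  have hm : Measurable fun ω => min 1 (edist (f ω) (g ω)) :=
    measurable_const.min (f.stronglyMeasurable.edist g.stronglyMeasurable).measurable
  rw [← t⁻¹.measurePreserving.lintegral_comp hm]
  refine lintegral_congr_ae ?_
  filter_upwards [act_ae t f, act_ae t g] with ω h1 h2
  rw [h1, h2]

theorem tendsto_act_metric {X Y : Type*} [MetricSpace X] [MetricSpace Y] [Infinite Y]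
    {l : Filter AutΩ} {t₀ : AutΩ}
    (h : ∀ r : L0 Y, Tendsto (fun t => (L0.pseudoEMetricSpace Y).edist (t.act r) (t₀.act r))
      l (𝓝 0)) (f : L0 X) :
    Tendsto (fun t => (L0.pseudoEMetricSpace X).edist (t.act f) (t₀.act f)) l (𝓝 0) := by
  let := L0.pseudoEMetricSpace X
  let := L0.pseudoEMetricSpace Y
  change Tendsto (fun t => edist (t.act f) (t₀.act f)) l (𝓝 0)
  -- the claim for functions of finite range
  have key : ∀ s : SimpleFunc Ω X, Tendsto (fun t : AutΩ =>
      edist (t.act (AEEqFun.mk s s.stronglyMeasurable.aestronglyMeasurable))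
        (t₀.act (AEEqFun.mk s s.stronglyMeasurable.aestronglyMeasurable))) l (𝓝 0) := by
    classical
    intro s
    obtain ⟨φ, hφ⟩ : ∃ φ : X → Y, InjOn φ s.range := by
      let e : s.range ↪ Y :=
        ((Fintype.equivFin s.range).toEmbedding.trans Fin.valEmbedding).trans
          (Infinite.natEmbedding Y)
      refine ⟨fun x => if hx : x ∈ s.range then e ⟨x, hx⟩ else Infinite.natEmbedding Y 0,
        fun x hx y hy hxy => ?_⟩
      have hx' : x ∈ s.range := hx
      have hy' : y ∈ s.range := hy
      simp only [hx', hy', dite_true] at hxy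
      simpa using hxy
    let a : X × X → ℝ≥0∞ := fun p => min 1 (edist (φ p.1) (φ p.2))
    let P := (s.range ×ˢ s.range).filter fun p => p.1 ≠ p.2
    let C : ℝ≥0∞ := ∑ p ∈ P, (a p)⁻¹
    have ha : ∀ p ∈ P, a p ≠ 0 := by
      intro p hp h0
      simp only [P, Finset.mem_filter, Finset.mem_product] at hp
      have h1 : φ p.1 ≠ φ p.2 := fun h => hp.2 (hφ hp.1.1 hp.1.2 h)
      exact (lt_min zero_lt_one (edist_pos.2 h1)).ne' h0
    have ha' : ∀ p, a p ≠ ⊤ := fun p => (lt_of_le_of_lt (min_le_left _ _) ENNReal.one_lt_top).ne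
    have hC : C ≠ ⊤ := by
      refine (ENNReal.sum_lt_top.2 fun p hp => ?_).ne
      exact (ENNReal.inv_ne_top.2 (ha p hp)).lt_top
    have hbound : ∀ x ∈ s.range, ∀ y ∈ s.range, min 1 (edist x y) ≤ C * a (x, y) := by
      intro x hx y hy
      by_cases hxy : x = y
      · simp [hxy]
      · have hp : (x, y) ∈ P := by simp [P, hx, hy, hxy]
        calc min 1 (edist x y) ≤ 1 := min_le_left _ _
          _ = (a (x, y))⁻¹ * a (x, y) := (ENNReal.inv_mul_cancel (ha _ hp) (ha' _)).symm
          _ ≤ C * a (x, y) := by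
            gcongr
            exact Finset.single_le_sum (f := fun p => (a p)⁻¹) (fun _ _ => zero_le) hp
    have hr := h (AEEqFun.mk (s.map φ) (s.map φ).stronglyMeasurable.aestronglyMeasurable)
    have hr' := ENNReal.Tendsto.const_mul hr (Or.inr hC)
    rw [mul_zero] at hr'
    refine tendsto_of_tendsto_of_tendsto_of_le_of_le tendsto_const_nhds hr' (fun _ => zero_le)
      (fun t => ?_)
    change ∫⁻ ω, _ ≤ C * ∫⁻ ω, _
    rw [← lintegral_const_mul' _ _ hC]
    refine lintegral_mono_ae ?_
    filter_upwards [act_ae t (AEEqFun.mk s s.stronglyMeasurable.aestronglyMeasurable),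
      act_ae t₀ (AEEqFun.mk s s.stronglyMeasurable.aestronglyMeasurable),
      act_ae t (AEEqFun.mk (s.map φ) (s.map φ).stronglyMeasurable.aestronglyMeasurable),
      act_ae t₀ (AEEqFun.mk (s.map φ) (s.map φ).stronglyMeasurable.aestronglyMeasurable),
      t⁻¹.measurePreserving.quasiMeasurePreserving.ae
        (AEEqFun.coeFn_mk s s.stronglyMeasurable.aestronglyMeasurable),
      t₀⁻¹.measurePreserving.quasiMeasurePreserving.ae
        (AEEqFun.coeFn_mk s s.stronglyMeasurable.aestronglyMeasurable),
      t⁻¹.measurePreserving.quasiMeasurePreserving.ae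
        (AEEqFun.coeFn_mk (s.map φ) (s.map φ).stronglyMeasurable.aestronglyMeasurable),
      t₀⁻¹.measurePreserving.quasiMeasurePreserving.ae
        (AEEqFun.coeFn_mk (s.map φ) (s.map φ).stronglyMeasurable.aestronglyMeasurable)]
      with ω h1 h2 h3 h4 h5 h6 h7 h8
    rw [h1, h2, h3, h4, h5, h6, h7, h8]
    exact hbound _ (s.mem_range_self _) _ (s.mem_range_self _)
  -- approximation by functions of finite range
  let s : ℕ → SimpleFunc Ω X := f.stronglyMeasurable.approx
  let F : ℕ → L0 X := fun n => AEEqFun.mk (s n) (s n).stronglyMeasurable.aestronglyMeasurable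
  have hF0 : Tendsto (fun n => edist (F n) f) atTop (𝓝 0) := by
    refine tendsto_iff_edist_tendsto_0.1
      (L0.tendsto_iff_metric.2 fun ns hns => ⟨id, strictMono_id, ?_⟩)
    have hall : ∀ᵐ ω : Ω, ∀ n, F n ω = s n ω := ae_all_iff.2 fun n => AEEqFun.coeFn_mk _ _
    filter_upwards [hall] with ω hω
    simp only [hω, id]
    exact (f.stronglyMeasurable.tendsto_approx ω).comp hns.tendsto_atTop
  rw [ENNReal.tendsto_nhds_zero] at hF0 ⊢
  intro ε hε
  have hε3 : 0 < ε / 3 := ENNReal.div_pos hε.ne' (by simp)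
  obtain ⟨n, hn⟩ := (hF0 (ε / 3) hε3).exists
  filter_upwards [ENNReal.tendsto_nhds_zero.1 (key (s n)) (ε / 3) hε3] with t ht
  calc edist (t.act f) (t₀.act f)
      ≤ edist (t.act f) (t.act (F n)) + edist (t.act (F n)) (t₀.act (F n))
          + edist (t₀.act (F n)) (t₀.act f) := edist_triangle4 _ _ _ _
    _ ≤ ε / 3 + ε / 3 + ε / 3 := by
        gcongr
        · rw [edist_comm]; exact (edist_act t (F n) f).trans_le hn
        · exact (edist_act t₀ (F n) f).trans_le hn
    _ = ε := ENNReal.add_thirds ε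

/-- For `r` fixed, `t ↦ t r` is continuous. -/
theorem continuous_act_left {X : Type*} [TopologicalSpace X] [TopologicalSpace.MetrizableSpace X]
    (f : L0 X) : Continuous fun t : AutΩ => t.act f := by
  let mI := TopologicalSpace.metrizableSpaceMetric unitInterval
  let mX := TopologicalSpace.metrizableSpaceMetric X
  rw [continuous_iff_continuousAt]
  intro t₀
  have : Infinite unitInterval := (Set.Icc_infinite zero_lt_one).to_subtype
  let := L0.pseudoEMetricSpace X
  refine tendsto_iff_edist_tendsto_0.2 (@tendsto_act_metric X unitInterval mX mI _ _ _ ?_ f)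
  intro r
  let := @L0.pseudoEMetricSpace unitInterval mI
  refine tendsto_iff_edist_tendsto_0.1 ?_
  have h1 : Continuous fun (t : AutΩ) (r : L0 unitInterval) => t.act r := continuous_induced_dom
  exact (continuous_pi_iff.1 h1 r).continuousAt

/-- The action of `Aut(Ω)` on `L⁰(Ω, X)` is jointly continuous. -/
theorem continuous_act {X : Type*} [TopologicalSpace X] [TopologicalSpace.MetrizableSpace X] :
    Continuous fun p : AutΩ × L0 X => p.1.act p.2 := by
  let mX := TopologicalSpace.metrizableSpaceMetric X
  rw [continuous_iff_continuousAt]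
  rintro ⟨t₀, f₀⟩
  have h1 : Tendsto (fun p : AutΩ × L0 X => p.1.act f₀) (𝓝 (t₀, f₀)) (𝓝 (t₀.act f₀)) :=
    ((continuous_act_left f₀).comp continuous_fst).continuousAt
  have h2 : Tendsto (fun p : AutΩ × L0 X => p.2) (𝓝 (t₀, f₀)) (𝓝 f₀) :=
    continuous_snd.continuousAt
  let := L0.pseudoEMetricSpace X
  have h3 := tendsto_iff_edist_tendsto_0.1 h1
  have h4 := tendsto_iff_edist_tendsto_0.1 h2
  refine tendsto_iff_edist_tendsto_0.2 ?_
  have h5 := h4.add h3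
  rw [add_zero] at h5
  refine tendsto_of_tendsto_of_tendsto_of_le_of_le tendsto_const_nhds h5 (fun _ => zero_le)
    (fun p => ?_)
  refine (edist_triangle _ (p.1.act f₀) _).trans ?_
  exact add_le_add_left (edist_act p.1 p.2 f₀).le _

/-- `Aut(Ω)` is a topological group. -/
instance instIsTopologicalGroup : IsTopologicalGroup AutΩ where
  continuous_mul := by
    refine continuous_induced_rng.2 (continuous_pi fun r => ?_)
    have : Continuous fun p : AutΩ × AutΩ => p.1.act (p.2.act r) :=
      continuous_act.comp (continuous_fst.prodMk ((continuous_act_left r).comp continuous_snd))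
    simpa only [Function.comp_def, mul_act] using this
  continuous_inv := by
    refine continuous_induced_rng.2 (continuous_pi fun r => ?_)
    let mI := TopologicalSpace.metrizableSpaceMetric unitInterval
    rw [continuous_iff_continuousAt]
    intro t₀
    have h1 : Tendsto (fun t : AutΩ => t.act (t₀⁻¹.act r)) (𝓝 t₀) (𝓝 (t₀.act (t₀⁻¹.act r))) :=
      (continuous_act_left _).continuousAt
    let := @L0.pseudoEMetricSpace unitInterval mI
    refine tendsto_iff_edist_tendsto_0.2 ((tendsto_iff_edist_tendsto_0.1 h1).congr fun t => ?_)
    have h2 : edist (t.act (t₀⁻¹.act r)) (t.act (t⁻¹.act r)) = edist (t₀⁻¹.act r) (t⁻¹.act r) :=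
      @edist_act unitInterval mI t (t₀⁻¹.act r) (t⁻¹.act r)
    rw [← mul_act t t⁻¹, mul_inv_cancel, one_act] at h2
    rw [← mul_act t₀ t₀⁻¹, mul_inv_cancel, one_act, h2, edist_comm]
    rfl

end AutΩ

namespace L0

instance instFirstCountableTopology {X : Type*} [TopologicalSpace X]
    [TopologicalSpace.MetrizableSpace X] : FirstCountableTopology (L0 X) :=
  letI := TopologicalSpace.metrizableSpaceMetric X
  letI := pseudoEMetricSpace X
  (inferInstance : FirstCountableTopology (L0 X))

/-- `L⁰(Ω, G)` is a topological group under pointwise multiplication. -/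
instance instIsTopologicalGroup {G : Type*} [Group G] [TopologicalSpace G] [IsTopologicalGroup G]
    [TopologicalSpace.MetrizableSpace G] : IsTopologicalGroup (L0 G) where
  continuous_mul := by
    refine continuous_iff_seqContinuous.2 fun u p hu => ?_
    have h1 := tendsto_iff.1 ((continuous_fst.tendsto p).comp hu)
    have h2 := tendsto_iff.1 ((continuous_snd.tendsto p).comp hu)
    refine tendsto_iff.2 fun ns hns => ?_
    obtain ⟨ms, hms, h3⟩ := h1 ns hns
    obtain ⟨ls, hls, h4⟩ := h2 (ns ∘ ms) (hns.comp hms)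
    refine ⟨ms ∘ ls, hms.comp hls, ?_⟩
    have h5 : ∀ᵐ ω : Ω, ∀ n, ((u n).1 * (u n).2) ω = (u n).1 ω * (u n).2 ω :=
      ae_all_iff.2 fun n => AEEqFun.coeFn_mul _ _
    filter_upwards [h3, h4, h5, AEEqFun.coeFn_mul p.1 p.2] with ω h3 h4 h5 h6
    simp only [Function.comp_apply, h5, h6]
    exact (h3.comp hls.tendsto_atTop).mul h4
  continuous_inv := by
    refine continuous_iff_seqContinuous.2 fun u p hu => ?_
    have h1 := tendsto_iff.1 hu
    refine tendsto_iff.2 fun ns hns => ?_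
    obtain ⟨ms, hms, h3⟩ := h1 ns hns
    refine ⟨ms, hms, ?_⟩
    have h5 : ∀ᵐ ω : Ω, ∀ n, (u n)⁻¹ ω = (u n ω)⁻¹ :=
      ae_all_iff.2 fun n => AEEqFun.coeFn_inv _
    filter_upwards [h3, h5, AEEqFun.coeFn_inv p] with ω h3 h5 h6
    simp only [Function.comp_apply, h5, h6]
    exact h3.inv

end L0

section Wreath

variable (G : Type*) [Group G] [TopologicalSpace G] [IsTopologicalGroup G]

/-- The action of `Aut(Ω)` on `L⁰(Ω, G)` by group automorphisms. -/
def autHom : AutΩ →* MulAut (L0 G) where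
  toFun t :=
    { toFun := t.act
      invFun := t⁻¹.act
      left_inv := fun g => by rw [← AutΩ.mul_act, inv_mul_cancel, AutΩ.one_act]
      right_inv := fun g => by rw [← AutΩ.mul_act, mul_inv_cancel, AutΩ.one_act]
      map_mul' := fun g h => AEEqFun.ext <| by
        filter_upwards [t.act_ae (g * h), AEEqFun.coeFn_mul (t.act g) (t.act h), t.act_ae g,
          t.act_ae h, t⁻¹.measurePreserving.quasiMeasurePreserving.ae (AEEqFun.coeFn_mul g h)]
          with ω h1 h2 h3 h4 h5
        rw [h1, h2, h5, Pi.mul_apply, Pi.mul_apply, h3, h4] }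
  map_one' := by ext1 g; exact AutΩ.one_act g
  map_mul' t u := by ext1 g; exact AutΩ.mul_act t u g

/-- The measurable wreath product `G ≀ Ω = L⁰(Ω, G) ⋊ Aut(Ω)`. -/
abbrev Wreath : Type _ := L0 G ⋊[autHom G] AutΩ

variable [TopologicalSpace.MetrizableSpace G]

namespace Wreath

/-- `G ≀ Ω` carries the product topology. -/
instance instTopologicalSpace : TopologicalSpace (Wreath G) :=
  TopologicalSpace.induced (fun x => (x.left, x.right)) instTopologicalSpaceProd

variable {G} in
theorem continuous_left : Continuous fun x : Wreath G => x.left :=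
  continuous_fst.comp
    (continuous_induced_dom (f := fun x : Wreath G => (x.left, x.right)))

variable {G} in
theorem continuous_right : Continuous fun x : Wreath G => x.right :=
  continuous_snd.comp
    (continuous_induced_dom (f := fun x : Wreath G => (x.left, x.right)))

instance instIsTopologicalGroup : IsTopologicalGroup (Wreath G) where
  continuous_mul := by
    refine continuous_induced_rng.2 (Continuous.prodMk ?_ ?_)
    · exact (continuous_left.comp continuous_fst).mul (AutΩ.continuous_act.comp
        ((continuous_right.comp continuous_fst).prodMk (continuous_left.comp continuous_snd)))
    · exact (continuous_right.comp continuous_fst).mul (continuous_right.comp continuous_snd)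
  continuous_inv := by
    refine continuous_induced_rng.2 (Continuous.prodMk ?_ ?_)
    · exact AutΩ.continuous_act.comp (continuous_right.inv.prodMk continuous_left.inv)
    · exact continuous_right.inv

end Wreath

end Wreath

section Roelcke

/-- A copy of the group `G` carrying its Roelcke uniformity. -/
def WithRoelcke (G : Type*) : Type _ := G

/-- The identity map from `G` to its copy. -/
def WithRoelcke.of {G : Type*} (g : G) : WithRoelcke G := g

variable (G : Type*) [Group G]

/-- `G` acts on itself by left translations. -/
instance WithRoelcke.instMulAction : MulAction G (WithRoelcke G) := inferInstanceAs (MulAction G G)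

variable [TopologicalSpace G] [IsTopologicalGroup G]

/-- The Roelcke (or lower) uniformity of a topological group: the finest uniformity coarser than
both the left and the right uniformity. (In Mathlib's order on uniform structures the coarser
ones are the larger ones.) -/
instance WithRoelcke.instUniformSpace : UniformSpace (WithRoelcke G) :=
  (IsTopologicalGroup.leftUniformSpace G ⊔ IsTopologicalGroup.rightUniformSpace G :
    UniformSpace G)

theorem WithRoelcke.left_le :
    IsTopologicalGroup.leftUniformSpace G ≤ WithRoelcke.instUniformSpace G := le_sup_left

theorem WithRoelcke.right_le :
    IsTopologicalGroup.rightUniformSpace G ≤ WithRoelcke.instUniformSpace G := le_sup_right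

instance WithRoelcke.instUniformContinuousConstSMul :
    UniformContinuousConstSMul G (WithRoelcke G) where
  uniformContinuous_const_smul g := by
    have hL : IsTopologicalGroup.leftUniformSpace G ≤
        (IsTopologicalGroup.leftUniformSpace G).comap (fun x : G => g * x) := by
      change comap _ _ ≤ comap _ (comap _ _)
      rw [comap_comap]
      refine le_of_eq ?_
      congr 1
      ext p
      simp [mul_assoc]
    have hR : IsTopologicalGroup.rightUniformSpace G ≤
        (IsTopologicalGroup.rightUniformSpace G).comap (fun x : G => g * x) := by
      change comap _ _ ≤ comap _ (comap _ _)
      rw [comap_comap, ← tendsto_iff_comap]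
      have h1 : Tendsto (fun z : G => g * z * g⁻¹) (𝓝 1) (𝓝 1) := by
        have : Continuous fun z : G => g * z * g⁻¹ := by fun_prop
        simpa using this.tendsto 1
      refine (h1.comp (tendsto_comap (f := fun p : G × G => p.2 * p.1⁻¹))).congr fun p => ?_
      simp [mul_assoc]
    have h : (IsTopologicalGroup.leftUniformSpace G ⊔ IsTopologicalGroup.rightUniformSpace G) ≤
        UniformSpace.comap (fun x : G => g * x) (IsTopologicalGroup.leftUniformSpace G ⊔
          IsTopologicalGroup.rightUniformSpace G) :=
      sup_le (hL.trans (UniformSpace.comap_mono le_sup_left))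
        (hR.trans (UniformSpace.comap_mono le_sup_right))
    exact uniformContinuous_iff_le_comap.2 h

/-- The sets `{(x, y) | y ∈ U x U}`, for `U` a neighbourhood of the identity, form a basis of the
Roelcke uniformity. -/
theorem WithRoelcke.hasBasis_uniformity :
    (@uniformity G (WithRoelcke.instUniformSpace G)).HasBasis (fun U : Set G => U ∈ 𝓝 1)
      fun U => {p | ∃ u ∈ U, ∃ v ∈ U, p.2 = u * p.1 * v} := by
  let W : Set G → Set (G × G) := fun U => {p | ∃ u ∈ U, ∃ v ∈ U, p.2 = u * p.1 * v}
  have hW : Monotone W := by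
    rintro U V h p ⟨u, hu, v, hv, hp⟩
    exact ⟨u, h hu, v, h hv, hp⟩
  have hB : ((𝓝 (1 : G)).lift' W).HasBasis (fun U : Set G => U ∈ 𝓝 1) W :=
    (𝓝 (1 : G)).basis_sets.lift' hW
  let c : UniformSpace.Core G :=
    { uniformity := (𝓝 (1 : G)).lift' W
      refl := by
        rw [hB.ge_iff]
        rintro U hU p hp
        have hp' : p.1 = p.2 := hp
        exact ⟨1, mem_of_mem_nhds hU, 1, mem_of_mem_nhds hU, by simp [hp']⟩
      symm := by
        rw [hB.tendsto_iff hB]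
        intro U hU
        refine ⟨U⁻¹, inv_mem_nhds_one G hU, ?_⟩
        rintro p ⟨u, hu, v, hv, hp⟩
        refine ⟨u⁻¹, hu, v⁻¹, hv, ?_⟩
        simp [hp, mul_assoc]
      comp := by
        rw [hB.ge_iff]
        intro U hU
        obtain ⟨V, hV, hVU⟩ := exists_nhds_one_split hU
        refine mem_of_superset (mem_lift' (hB.mem_of_mem hV)) ?_
        rintro ⟨x, z⟩ ⟨y, ⟨u, hu, v, hv, h1⟩, ⟨u', hu', v', hv', h2⟩⟩
        refine ⟨u' * u, hVU _ hu' _ hu, v * v', hVU _ hv _ hv', ?_⟩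
        simp only at h1 h2
        simp [h1, h2, mul_assoc] }
  have hL : IsTopologicalGroup.leftUniformSpace G ≤ UniformSpace.ofCore c := by
    change comap _ _ ≤ (𝓝 (1 : G)).lift' W
    rw [hB.ge_iff]
    intro U hU
    refine ⟨U, hU, ?_⟩
    intro p hp
    exact ⟨1, mem_of_mem_nhds hU, _, hp, by simp⟩
  have hR : IsTopologicalGroup.rightUniformSpace G ≤ UniformSpace.ofCore c := by
    change comap _ _ ≤ (𝓝 (1 : G)).lift' W
    rw [hB.ge_iff]
    intro U hU
    refine ⟨U, hU, ?_⟩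
    intro p hp
    exact ⟨_, hp, 1, mem_of_mem_nhds hU, by simp⟩
  have hS : WithRoelcke.instUniformSpace G ≤ UniformSpace.ofCore c := sup_le hL hR
  refine ⟨fun E => ⟨fun hE => ?_, fun ⟨U, hU, hUE⟩ => mem_of_superset (hS (hB.mem_of_mem hU)) hUE⟩⟩
  obtain ⟨F, hF, hFE⟩ := @comp_mem_uniformity_sets G (WithRoelcke.instUniformSpace G) E hE
  obtain ⟨U, hU, hUF⟩ := WithRoelcke.left_le G hF
  obtain ⟨V, hV, hVF⟩ := WithRoelcke.right_le G hF
  refine ⟨U ∩ V, inter_mem hU hV, ?_⟩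
  rintro ⟨x, y⟩ ⟨u, hu, v, hv, h⟩
  refine hFE ⟨u * x, hVF (by simpa using hu.2), hUF ?_⟩
  simp only at h
  simpa [h, mul_assoc] using hv.1

instance WithRoelcke.instIsCountablyGenerated [FirstCountableTopology G] :
    (uniformity (WithRoelcke G)).IsCountablyGenerated := by
  obtain ⟨U, hU⟩ := (𝓝 (1 : G)).exists_antitone_basis
  have h : (uniformity (WithRoelcke G)).HasBasis (fun _ : ℕ => True)
      fun n => {p : G × G | ∃ u ∈ U n, ∃ v ∈ U n, p.2 = u * p.1 * v} := by
    refine (WithRoelcke.hasBasis_uniformity G).to_hasBasis (fun V hV => ?_)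
      fun n _ => ⟨U n, hU.mem n, Subset.rfl⟩
    obtain ⟨n, hn⟩ := hU.mem_iff.1 hV
    refine ⟨n, trivial, ?_⟩
    rintro p ⟨u, hu, v, hv, hp⟩
    exact ⟨u, hn hu, v, hn hv, hp⟩
  exact h.isCountablyGenerated

instance WithRoelcke.instSeparableSpace [TopologicalSpace.SeparableSpace G] :
    TopologicalSpace.SeparableSpace (WithRoelcke G) := by
  have hle := UniformSpace.toTopologicalSpace_mono (WithRoelcke.left_le G)
  have hc : @Continuous G (WithRoelcke G) _ _ WithRoelcke.of := continuous_id_iff_le.2 hle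
  have hs : Function.Surjective (WithRoelcke.of : G → WithRoelcke G) := fun x => ⟨x, rfl⟩
  exact hs.denseRange.separableSpace hc

/-- The Roelcke completion `R(G)`: the (Hausdorff) completion of `G` for its Roelcke uniformity.
The group `G` acts on it by the continuous extension of its left translations. -/
abbrev RoelckeCompletion : Type _ := UniformSpace.Completion (WithRoelcke G)

/-- The canonical map `G → R(G)`. -/
def toRoelcke (g : G) : RoelckeCompletion G := (WithRoelcke.of g : WithRoelcke G)

/-- The distinguished point of `R(G)`: the image of the identity of `G`. -/
def roelckeBase : RoelckeCompletion G := toRoelcke G 1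

/-- A topological group is Roelcke precompact if its Roelcke completion is compact. -/
def IsRoelckePrecompact : Prop := CompactSpace (RoelckeCompletion G)

namespace RoelckeCompletion

instance instMeasurableSpace : MeasurableSpace (RoelckeCompletion G) := borel _

instance instBorelSpace : BorelSpace (RoelckeCompletion G) := ⟨rfl⟩

instance instContinuousSMul : ContinuousSMul G (RoelckeCompletion G) where
  continuous_smul := by
    rw [continuous_iff_continuousAt]
    rintro ⟨g₀, z₀⟩
    have h1 : Tendsto (fun p : G × RoelckeCompletion G => g₀ • p.2) (𝓝 (g₀, z₀))
        (𝓝 (g₀ • z₀)) :=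
      ((continuous_const_smul g₀).comp continuous_snd).continuousAt
    refine h1.congr_uniformity ?_
    rw [uniformity_hasBasis_closed.tendsto_right_iff]
    rintro V ⟨hV, hVc⟩
    have hV' : {p : G × G | (toRoelcke G p.1,
        toRoelcke G p.2) ∈ V} ∈
        (IsTopologicalGroup.rightUniformSpace G).uniformity :=
      WithRoelcke.right_le G
        (UniformSpace.Completion.uniformContinuous_coe (WithRoelcke G) hV)
    obtain ⟨U, hU, hUV⟩ := hV'
    have key : ∀ u ∈ U, ∀ z : RoelckeCompletion G, (z, u • z) ∈ V := by
      intro u hu z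
      refine UniformSpace.Completion.induction_on z ?_ ?_
      · exact hVc.preimage (continuous_id.prodMk (continuous_const_smul u))
      · intro x
        rw [← UniformSpace.Completion.coe_smul]
        refine @hUV ((show G from x), u * (show G from x)) ?_
        change u * (show G from x) * (show G from x)⁻¹ ∈ U
        rwa [mul_inv_cancel_right]
    have h2 : ∀ᶠ p : G × RoelckeCompletion G in 𝓝 (g₀, z₀), p.1 * g₀⁻¹ ∈ U := by
      have : Continuous fun p : G × RoelckeCompletion G => p.1 * g₀⁻¹ := by fun_prop
      exact this.continuousAt.eventually_mem (by simpa using hU)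
    filter_upwards [h2] with p hp
    simpa [mul_smul] using key _ hp (g₀ • p.2)

instance instPolishSpace [PolishSpace G] : PolishSpace (RoelckeCompletion G) := by
  let := UniformSpace.pseudoMetricSpace (WithRoelcke G)
  have : SecondCountableTopology (RoelckeCompletion G) :=
    UniformSpace.secondCountable_of_separable _
  infer_instance

end RoelckeCompletion

end Roelcke

section Markov

/-- The Markov randomization `𝓜(Ω, K)`: the space of Borel probability measures on `Ω × K × Ω` both
of whose marginals on `Ω` are Lebesgue measure, with the topology of weak convergence of measures,
i.e. the weak-* topology. -/
def Markov (K : Type*) [TopologicalSpace K] [MeasurableSpace K] : Type _ :=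
  {l : ProbabilityMeasure (Ω × K × Ω) //
    (l : Measure (Ω × K × Ω)).map (fun p => p.1) = volume ∧
    (l : Measure (Ω × K × Ω)).map (fun p => p.2.2) = volume}

namespace Markov

variable {K : Type*} [TopologicalSpace K] [MeasurableSpace K]

instance instTopologicalSpace [BorelSpace K] : TopologicalSpace (Markov K) :=
  instTopologicalSpaceSubtype

/-- The underlying measure of a point of `𝓜(Ω, K)`. -/
def toMeasure (l : Markov K) : Measure (Ω × K × Ω) := (l.1 : Measure (Ω × K × Ω))

theorem ext {l l' : Markov K} (h : l.toMeasure = l'.toMeasure) : l = l' :=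
  Subtype.ext (Subtype.ext h)

theorem measurePreserving_fst (l : Markov K) :
    MeasurePreserving (fun p : Ω × K × Ω => p.1) l.toMeasure (volume : Measure Ω) :=
  ⟨measurable_fst, l.2.1⟩

theorem measurePreserving_snd (l : Markov K) :
    MeasurePreserving (fun p : Ω × K × Ω => p.2.2) l.toMeasure (volume : Measure Ω) :=
  ⟨measurable_snd.snd, l.2.2⟩

instance (l : Markov K) : IsProbabilityMeasure l.toMeasure := l.1.2

/-- The point `[s, k, r]` of `𝓜(Ω, K)`: the joint law of `(s, k, r)`, where
`s, r ∈ End(Ω)` and `k ∈ L⁰(Ω, K)`. -/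
def law [BorelSpace K] [TopologicalSpace.PseudoMetrizableSpace K] (s : EndΩ) (k : L0 K)
    (r : EndΩ) : Markov K :=
  have h : Measurable fun ω => (s.1 ω, k ω, r.1 ω) :=
    s.2.measurable.prodMk (k.stronglyMeasurable.measurable.prodMk r.2.measurable)
  ⟨⟨(volume : Measure Ω).map fun ω => (s.1 ω, k ω, r.1 ω),
    Measure.isProbabilityMeasure_map h.aemeasurable⟩,
    (Measure.map_map measurable_fst h).trans s.2.map_eq,
    (Measure.map_map measurable_snd.snd h).trans r.2.map_eq⟩

/-- The distinguished point `[1, k₀, 1]` of `𝓜(Ω, K)`, for `k₀ ∈ K` seen as a constant random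
variable. -/
def base [BorelSpace K] [TopologicalSpace.PseudoMetrizableSpace K] (k₀ : K) : Markov K :=
  law 1 (AEEqFun.const Ω k₀) 1

section Action

variable {G : Type*} [Group G] [TopologicalSpace G] [IsTopologicalGroup G] [PolishSpace G]
  [MulAction G K]

/-- The transformation `(ω₀, k, ω₁) ↦ (t ω₀, g(t ω₀) k, ω₁)` of `Ω × K × Ω` induced by
the element `x = g t` of `G ≀ Ω`. -/
def actMap (x : Wreath G) (p : Ω × K × Ω) : Ω × K × Ω :=
  (x.right.toFun p.1, x.left (x.right.toFun p.1) • p.2.1, p.2.2)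

variable [BorelSpace K] [PolishSpace K] [ContinuousSMul G K]

set_option linter.unusedSectionVars false in
theorem measurable_smul_aux (g : L0 G) : Measurable fun p : Ω × K => g p.1 • p.2 := by
  let : MeasurableSpace G := borel G
  have : BorelSpace G := ⟨rfl⟩
  have h : Measurable fun p : G × K => p.1 • p.2 := continuous_smul.measurable
  exact h.comp ((g.stronglyMeasurable.measurable.comp measurable_fst).prodMk measurable_snd)

theorem measurable_actMap (x : Wreath G) :
    Measurable (actMap x : Ω × K × Ω → Ω × K × Ω) := by
  have h1 : Measurable fun p : Ω × K × Ω => x.right.toFun p.1 :=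
    x.right.measurePreserving.measurable.comp measurable_fst
  exact h1.prodMk (((measurable_smul_aux x.left).comp (h1.prodMk measurable_snd.fst)).prodMk
    measurable_snd.snd)

/-- The action of `G ≀ Ω` on `𝓜(Ω, K)` induced by a continuous action of `G` on `K`: the element
`g t` maps a measure to its image under `(ω₀, k, ω₁) ↦ (t ω₀, g(t ω₀) k, ω₁)`. -/
instance instSMul : SMul (Wreath G) (Markov K) where
  smul x l := ⟨⟨l.toMeasure.map (actMap x),
      Measure.isProbabilityMeasure_map (measurable_actMap x).aemeasurable⟩,
    (Measure.map_map measurable_fst (measurable_actMap x)).trans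
      (x.right.measurePreserving.comp l.measurePreserving_fst).map_eq,
    (Measure.map_map measurable_snd.snd (measurable_actMap x)).trans
      l.measurePreserving_snd.map_eq⟩

theorem toMeasure_smul (x : Wreath G) (l : Markov K) :
    (x • l).toMeasure = l.toMeasure.map (actMap x) := rfl

instance instMulAction : MulAction (Wreath G) (Markov K) where
  one_smul l := ext <| by
    have h : actMap (1 : Wreath G) =ᵐ[l.toMeasure] (id : Ω × K × Ω → Ω × K × Ω) := by
      filter_upwards [l.measurePreserving_fst.quasiMeasurePreserving.ae AutΩ.one_ae,
        l.measurePreserving_fst.quasiMeasurePreserving.ae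
          (AEEqFun.coeFn_one (α := Ω) (μ := volume) (β := G))] with p h1 h2
      simp only [actMap, SemidirectProduct.one_right, SemidirectProduct.one_left, h1, h2,
        Pi.one_apply, one_smul, id]
    rw [toMeasure_smul, Measure.map_congr h, Measure.map_id]
  mul_smul x y l := ext <| by
    have h : actMap (x * y) =ᵐ[l.toMeasure] (actMap x ∘ actMap y : Ω × K × Ω → Ω × K × Ω) := by
      have hq := l.measurePreserving_fst.quasiMeasurePreserving
      have hy := y.right.measurePreserving.quasiMeasurePreserving
      have hx := x.right.measurePreserving.quasiMeasurePreserving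
      filter_upwards [hq.ae (AutΩ.mul_ae x.right y.right),
        hq.ae (hy.ae (hx.ae (AEEqFun.coeFn_mul x.left (x.right.act y.left)))),
        hq.ae (hy.ae (hx.ae (x.right.act_ae y.left))),
        hq.ae (hy.ae x.right.inv_apply_ae)] with p h1 h2 h3 h4
      have h5 : (x * y).left = x.left * x.right.act y.left := rfl
      simp only [actMap, Function.comp_apply, SemidirectProduct.mul_right, h5, h1, h2,
        Pi.mul_apply, h3, h4, mul_smul]
    rw [toMeasure_smul, toMeasure_smul, toMeasure_smul, Measure.map_congr h,
      Measure.map_map (measurable_actMap x) (measurable_actMap y)]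

/-- The action of `t ∈ Aut(Ω)` is given by `t [s, k, r] = [t s, k, r]`. -/
theorem inr_smul_law (t : AutΩ) (s : EndΩ) (k : L0 K) (r : EndΩ) :
    (SemidirectProduct.inr t : Wreath G) • law s k r = law (Units.val t * s) k r := ext <| by
  have hm : Measurable fun ω => (s.1 ω, k ω, r.1 ω) :=
    s.2.measurable.prodMk (k.stronglyMeasurable.measurable.prodMk r.2.measurable)
  refine (Measure.map_map (measurable_actMap _) hm).trans (Measure.map_congr ?_)
  have hs := s.2.quasiMeasurePreserving
  filter_upwards [EndΩ.mul_ae (Units.val t) s, hs.ae (t.measurePreserving.quasiMeasurePreserving.ae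
    (AEEqFun.coeFn_one (α := Ω) (μ := volume) (β := G)))] with ω h1 h2
  simp only [Function.comp_apply, actMap, SemidirectProduct.right_inr, SemidirectProduct.left_inr,
    h1, h2, Pi.one_apply, one_smul]
  rfl

/-- The action of `g ∈ L⁰(Ω, G)` is given by `g [s, k, r] = [s, k', r]` with
`k'(ω) = g(s ω) k(ω)`. -/
theorem inl_smul_law (g : L0 G) (s : EndΩ) (k k' : L0 K) (r : EndΩ)
    (hk : ∀ᵐ ω : Ω, k' ω = g (s.1 ω) • k ω) :
    (SemidirectProduct.inl g : Wreath G) • law s k r = law s k' r := ext <| by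
  have hm : Measurable fun ω => (s.1 ω, k ω, r.1 ω) :=
    s.2.measurable.prodMk (k.stronglyMeasurable.measurable.prodMk r.2.measurable)
  refine (Measure.map_map (measurable_actMap _) hm).trans (Measure.map_congr ?_)
  filter_upwards [s.2.quasiMeasurePreserving.ae AutΩ.one_ae, hk] with ω h1 h2
  simp only [Function.comp_apply, actMap, SemidirectProduct.right_inl, SemidirectProduct.left_inl,
    h1, h2]

end Action

end Markov

end Markov

/-- `(K, k₀)` is a compactification (or ambit) of the topological group `G`: the space `K` is
compact Hausdorff, the action of `G` on `K` is continuous and the orbit of `k₀` is dense. -/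
structure IsCompactification (G : Type*) [Group G] [TopologicalSpace G] (K : Type*)
    [TopologicalSpace K] [MulAction G K] (k₀ : K) : Prop where
  compactSpace : CompactSpace K
  t2Space : T2Space K
  continuousSMul : ContinuousSMul G K
  dense_orbit : Dense (MulAction.orbit G k₀)

end
end Randomization

namespace Randomization

noncomputable section

open MeasureTheory Filter Topology Set
open scoped ENNReal

/-! Write `H = G ≀ Ω`. The image of the distinguished point under `x = g t` is the law of the random
variable `(1, g k₀, t⁻¹)` (`orbitVar`, `toMeasure_smul_base`). The theorem amounts to saying that
the orbit map `x ↦ x • [1, k₀, 1]` exhibits `𝓜(Ω, R(G))` as a completion of `H` for its Roelcke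
uniformity. The homeomorphism then comes from uniqueness of completions, and equivariance is checked
on the dense image of `H`.

Composing a random variable with an element of `Aut(Ω)` does not change its law. Conversely, two
random variables in a compact space with nearby laws become close in measure after such a
composition (`exists_nhds_forall_exists_aut`): cut the space into finitely many small pieces with
null boundaries, and match two partitions of `Ω` with almost equal measures by moving both to
consecutive intervals (`exists_aut_index_ne_le`).

The orbit map therefore induces the Roelcke uniformity (`isUniformInducing_orbitMap`) once the
following are compared: `y = u x v` with `u, v` near `1`, and closeness in measure of the variable
of `x` to that of `y` composed with some `s`. If `y = u x v`, take for `s` the `Aut(Ω)` component of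
`u` (`exists_nhds_orbitVar_mul_mul`). Conversely, closeness of the middle coordinates in `R(G)`
means that `y(s ω) = a x(ω) b` with small `a, b ∈ G` for most `ω`; a measurable choice of `a`,
together with `s`, defines `u`, and then `v` is forced (`exists_uniformity_eq_mul_mul_of_orbitVar`).

The orbit is dense (`dense_orbit_base`) because every point of `𝓜(Ω, R(G))` is the law of a triple
on `Ω`, whose outer coordinates are approximated by automorphisms and whose middle one by a
`G`-valued map. Compactness of `R(G)` makes `𝓜(Ω, R(G))` compact, hence complete, and supplies the
finite partitions and the uniform continuity of test functions. -/

/-! ### Quantile functions and automorphisms matching two partitions -/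

/-- Cumulative distribution and quantile function of an atomless probability measure on `ℝ`. -/
theorem exists_quantile (ν : Measure ℝ) [IsProbabilityMeasure ν] [NullSingletonClass ν] :
    ∃ (F : ℝ → Ω) (Q : Ω → ℝ), Monotone F ∧ Measurable Q ∧
      (volume : Measure Ω).map Q = ν ∧ (∀ᵐ t : Ω, F (Q t) = t) ∧
      ∀ x, (F x : ℝ) = ν.real (Iic x) := by
  have hF0 : ∀ x, 0 ≤ ν.real (Iic x) := fun x => measureReal_nonneg
  have hF1 : ∀ x, ν.real (Iic x) ≤ 1 := fun x => measureReal_le_one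
  have hmono : Monotone fun x => ν.real (Iic x) := fun x y h =>
    measureReal_mono (Iic_subset_Iic.2 h)
  -- The jumps of a distribution function are the masses of its atoms, and there are none.
  have hcont : Continuous fun x => ν.real (Iic x) := by
    have h : (fun x => ν.real (Iic x)) = ProbabilityTheory.cdf ν := by
      ext x; rw [ProbabilityTheory.cdf_eq_real]
    rw [h, continuous_iff_continuousAt]
    intro x
    rw [(ProbabilityTheory.cdf ν).mono.continuousAt_iff_leftLim_eq_rightLim]
    have h1 : (ProbabilityTheory.cdf ν).measure {x} = 0 := by
      rw [ProbabilityTheory.measure_cdf]; exact measure_singleton x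
    rw [StieltjesFunction.measure_singleton, ENNReal.ofReal_eq_zero, sub_nonpos] at h1
    rw [StieltjesFunction.rightLim_eq]
    exact le_antisymm ((ProbabilityTheory.cdf ν).mono.leftLim_le le_rfl) h1
  have htop : Tendsto (fun x => ν.real (Iic x)) atTop (𝓝 1) := by
    simpa [← ProbabilityTheory.cdf_eq_real] using ProbabilityTheory.tendsto_cdf_atTop ν
  have hbot : Tendsto (fun x => ν.real (Iic x)) atBot (𝓝 0) := by
    simpa [← ProbabilityTheory.cdf_eq_real] using ProbabilityTheory.tendsto_cdf_atBot ν
  -- At the endpoints `0` and `1` the set may be unbounded below or empty, so an arbitrary value is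
  -- used there; they form a null set. On the open interval, `Q t ≤ x ↔ t ≤ F x`.
  let Q : Ω → ℝ := fun t => if t ∈ Ioo (0 : Ω) 1 then sInf {x | (t : ℝ) ≤ ν.real (Iic x)} else 0
  have hQ : ∀ t ∈ Ioo (0 : Ω) 1, ∀ x, Q t ≤ x ↔ (t : ℝ) ≤ ν.real (Iic x) := by
    intro t ht x
    have ht0 : (0 : ℝ) < t := ht.1
    have ht1 : (t : ℝ) < 1 := ht.2
    have hne : {x | (t : ℝ) ≤ ν.real (Iic x)}.Nonempty :=
      ((htop.eventually (lt_mem_nhds ht1)).exists).imp fun _ h => le_of_lt h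
    obtain ⟨b, hb⟩ := (hbot.eventually (gt_mem_nhds ht0)).exists
    have hbdd : BddBelow {x | (t : ℝ) ≤ ν.real (Iic x)} := ⟨b, fun y hy => by
      by_contra! h
      exact absurd (hmono h.le) (not_le.2 (lt_of_lt_of_le hb hy))⟩
    have hcl : IsClosed {x | (t : ℝ) ≤ ν.real (Iic x)} := isClosed_le continuous_const hcont
    have hmem := hcl.csInf_mem hne hbdd
    simp only [Q, if_pos ht]
    exact ⟨fun h => le_trans hmem (hmono h), fun h => csInf_le hbdd h⟩
  have hae : ∀ᵐ t : Ω, t ∈ Ioo (0 : Ω) 1 := by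
    refine (mem_ae_iff_prob_eq_one measurableSet_Ioo).2 ?_
    simp
  have hQm : Measurable Q := by
    refine measurable_of_Iic fun x => ?_
    have : Q ⁻¹' Iic x = (Ioo 0 1 ∩ {t : Ω | (t : ℝ) ≤ ν.real (Iic x)}) ∪
        ((Ioo 0 1)ᶜ ∩ {_t | 0 ≤ x}) := by
      ext t
      by_cases ht : t ∈ Ioo (0 : Ω) 1
      · simp only [mem_preimage, mem_Iic, hQ t ht, mem_union, mem_inter_iff, ht, true_and,
          mem_compl_iff, not_true, false_and, or_false, mem_ofPred_eq]
      · simp only [mem_preimage, mem_Iic, mem_union, mem_inter_iff, ht, false_and, false_or,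
          mem_compl_iff, not_false_eq_true, true_and, mem_ofPred_eq, Q, if_false]
    rw [this]
    exact (measurableSet_Ioo.inter (measurableSet_le measurable_subtype_coe
      measurable_const)).union (measurableSet_Ioo.compl.inter (MeasurableSet.const _))
  refine ⟨fun x => ⟨ν.real (Iic x), hF0 x, hF1 x⟩, Q, fun x y h => hmono h, hQm, ?_, ?_,
    fun x => rfl⟩
  · have := Measure.isProbabilityMeasure_map (μ := (volume : Measure Ω)) hQm.aemeasurable
    refine Measure.ext_of_Iic _ _ fun x => ?_
    rw [Measure.map_apply hQm measurableSet_Iic]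
    have : Q ⁻¹' Iic x =ᵐ[volume] Iic (⟨ν.real (Iic x), hF0 x, hF1 x⟩ : Ω) := by
      filter_upwards [hae] with t ht
      exact propext (hQ t ht x)
    rw [measure_congr this, unitInterval.volume_Iic, ofReal_measureReal]
  · filter_upwards [hae] with t ht
    refine Subtype.ext (le_antisymm ?_ ((hQ t ht _).1 le_rfl))
    by_contra! hlt
    have h1 : ∀ᶠ x in 𝓝[<] (Q t), (t : ℝ) < ν.real (Iic x) :=
      (hcont.continuousAt.eventually (lt_mem_nhds hlt)).filter_mono nhdsWithin_le_nhds
    obtain ⟨x, hx, hxQ⟩ := (h1.and self_mem_nhdsWithin).exists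
    exact absurd ((hQ t ht x).2 hx.le) (not_le.2 hxQ)

namespace AutΩ

/-- Two measure-preserving maps that are inverse to each other almost everywhere define an element
of `Aut(Ω)`. -/
def ofMaps (f g : Ω → Ω) (hf : MeasurePreserving f (volume : Measure Ω) volume)
    (hg : MeasurePreserving g (volume : Measure Ω) volume) (hgf : ∀ᵐ ω : Ω, g (f ω) = ω)
    (hfg : ∀ᵐ ω : Ω, f (g ω) = ω) : AutΩ where
  val := ⟨AEEqFun.mk f hf.measurable.aestronglyMeasurable,
    hf.congr (AEEqFun.stronglyMeasurable _).measurable (AEEqFun.coeFn_mk _ _).symm⟩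
  inv := ⟨AEEqFun.mk g hg.measurable.aestronglyMeasurable,
    hg.congr (AEEqFun.stronglyMeasurable _).measurable (AEEqFun.coeFn_mk _ _).symm⟩
  val_inv := EndΩ.ext <| by
    have h1 := AEEqFun.coeFn_mk (μ := volume) f hf.measurable.aestronglyMeasurable
    have h2 := AEEqFun.coeFn_mk (μ := volume) g hg.measurable.aestronglyMeasurable
    filter_upwards [EndΩ.mul_ae ⟨AEEqFun.mk f hf.measurable.aestronglyMeasurable,
        hf.congr (AEEqFun.stronglyMeasurable _).measurable h1.symm⟩
      ⟨AEEqFun.mk g hg.measurable.aestronglyMeasurable,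
        hg.congr (AEEqFun.stronglyMeasurable _).measurable h2.symm⟩, h2,
      hg.quasiMeasurePreserving.ae h1, hfg, EndΩ.one_ae] with ω h3 h4 h5 h6 h7
    rw [h3, h7]
    simp only [h4, h5, h6]
  inv_val := EndΩ.ext <| by
    have h1 := AEEqFun.coeFn_mk (μ := volume) f hf.measurable.aestronglyMeasurable
    have h2 := AEEqFun.coeFn_mk (μ := volume) g hg.measurable.aestronglyMeasurable
    filter_upwards [EndΩ.mul_ae ⟨AEEqFun.mk g hg.measurable.aestronglyMeasurable,
        hg.congr (AEEqFun.stronglyMeasurable _).measurable h2.symm⟩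
      ⟨AEEqFun.mk f hf.measurable.aestronglyMeasurable,
        hf.congr (AEEqFun.stronglyMeasurable _).measurable h1.symm⟩, h1,
      hf.quasiMeasurePreserving.ae h2, hgf, EndΩ.one_ae] with ω h3 h4 h5 h6 h7
    rw [h3, h7]
    simp only [h4, h5, h6]

theorem ofMaps_ae (f g : Ω → Ω) (hf : MeasurePreserving f (volume : Measure Ω) volume)
    (hg : MeasurePreserving g (volume : Measure Ω) volume) (hgf : ∀ᵐ ω : Ω, g (f ω) = ω)
    (hfg : ∀ᵐ ω : Ω, f (g ω) = ω) : ∀ᵐ ω : Ω, (ofMaps f g hf hg hgf hfg).toFun ω = f ω :=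
  AEEqFun.coeFn_mk f hf.measurable.aestronglyMeasurable

theorem apply_inv_ae (t : AutΩ) : ∀ᵐ ω : Ω, t.toFun (t⁻¹.toFun ω) = ω := by
  simpa using t⁻¹.inv_apply_ae

end AutΩ

/-- For a measurable `a : Ω → ℕ`, there is an automorphism of `Ω` that sends the sets `{a = m}`
to consecutive intervals. -/
theorem exists_aut_consecutive (a : Ω → ℕ) (ha : Measurable a) :
    ∃ (t : AutΩ) (c : ℕ → Ω), (∀ m, (c m : ℝ) = volume.real {ω | a ω ≤ m}) ∧
      (∀ᵐ ω : Ω, t.toFun ω ≤ c (a ω)) ∧ ∀ᵐ ω : Ω, ∀ m < a ω, c m ≤ t.toFun ω := by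
  -- The set `{a = m}` is shifted into `[2m, 2m + 1]`, so that `q` is injective and `{a ≤ m}` is the
  -- sublevel set `{q ≤ 2m + 1}`. The automorphism is `F ∘ q`, with inverse `q⁻¹ ∘ Q`, and the cut
  -- points are the values `F (2m + 1)`.
  let q : Ω → ℝ := fun ω => 2 * a ω + ω
  have hqm : Measurable q := by
    have : Measurable fun ω => (a ω : ℝ) := measurable_from_top.comp ha
    exact (this.const_mul 2).add measurable_subtype_coe
  have hqle : ∀ ω (m : ℕ), q ω ≤ 2 * m + 1 ↔ a ω ≤ m := by
    intro ω m
    have h0 := ω.2.1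
    have h1 := ω.2.2
    constructor
    · intro h
      by_contra! hlt
      have : (m : ℝ) + 1 ≤ a ω := by exact_mod_cast hlt
      simp only [q] at h
      linarith
    · intro h
      have : (a ω : ℝ) ≤ m := by exact_mod_cast h
      simp only [q]
      linarith
  have hinj : Function.Injective q := by
    intro ω ω' h
    have h1 : a ω = a ω' := le_antisymm
      ((hqle ω _).1 (h ▸ (hqle ω' _).2 le_rfl)) ((hqle ω' _).1 (h ▸ (hqle ω _).2 le_rfl))
    simp only [q, h1] at h
    exact Subtype.ext (by linarith)
  have hemb := hqm.measurableEmbedding hinj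
  have := Measure.isProbabilityMeasure_map (μ := (volume : Measure Ω)) hqm.aemeasurable
  have : NullSingletonClass ((volume : Measure Ω).map q) := ⟨fun x => by
    rw [Measure.map_apply hqm (measurableSet_singleton x)]
    exact (subsingleton_singleton.preimage hinj).measure_zero _⟩
  obtain ⟨F, Q, hF, hQm, hQν, hFQ, hFx⟩ := exists_quantile ((volume : Measure Ω).map q)
  have hFm : Measurable F := hF.measurable
  let q' : ℝ → Ω := hemb.invFun
  have hq'm : Measurable q' := hemb.measurable_invFun
  have hq' : ∀ ω, q' (q ω) = ω := hemb.leftInverse_invFun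
  have hQmp : MeasurePreserving Q volume (volume.map q) := ⟨hQm, hQν⟩
  have hqmp : MeasurePreserving q volume (volume.map q) := ⟨hqm, rfl⟩
  have hFmp : MeasurePreserving F (volume.map q) volume := ⟨hFm, by
    rw [← hQν, Measure.map_map hFm hQm, Measure.map_congr (f := F ∘ Q) (g := id) hFQ, Measure.map_id]⟩
  have hq'mp : MeasurePreserving q' (volume.map q) volume := ⟨hq'm, by
    rw [Measure.map_map hq'm hqm, show q' ∘ q = id from funext hq', Measure.map_id]⟩
  have hQF : ∀ᵐ x ∂(volume.map q), Q (F x) = x := by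
    rw [← hQν]
    refine (ae_map_iff hQm.aemeasurable (measurableSet_eq_fun (hQm.comp hFm) measurable_id)).2 ?_
    filter_upwards [hFQ] with t ht
    simp only [Function.comp_apply, ht, id]
  have hqq' : ∀ᵐ x ∂(volume.map q), q (q' x) = x := by
    refine (ae_map_iff hqm.aemeasurable (measurableSet_eq_fun (hqm.comp hq'm) measurable_id)).2 ?_
    exact ae_of_all _ fun ω => by simp only [Function.comp_apply, hq', id]
  have h1 : ∀ᵐ ω : Ω, q' (Q (F (q ω))) = ω := by
    filter_upwards [hqmp.quasiMeasurePreserving.ae hQF] with ω h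
    rw [h, hq']
  have h2 : ∀ᵐ ω : Ω, F (q (q' (Q ω))) = ω := by
    filter_upwards [hQmp.quasiMeasurePreserving.ae hqq', hFQ] with ω h h'
    rw [h, h']
  have hae := AutΩ.ofMaps_ae (fun ω => F (q ω)) (fun ω => q' (Q ω)) (hFmp.comp hqmp)
    (hq'mp.comp hQmp) h1 h2
  refine ⟨AutΩ.ofMaps (fun ω => F (q ω)) (fun ω => q' (Q ω)) (hFmp.comp hqmp)
    (hq'mp.comp hQmp) h1 h2, fun m => F (2 * m + 1), fun m => ?_, ?_, ?_⟩
  · rw [hFx, map_measureReal_apply hqm measurableSet_Iic]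
    congr 1
    ext ω
    exact hqle ω m
  · filter_upwards [hae] with ω h
    rw [h]
    exact hF ((hqle _ _).2 le_rfl)
  · filter_upwards [hae] with ω h m hm
    rw [h]
    exact hF (le_of_not_ge fun h' => absurd ((hqle _ _).1 h') (not_le.2 hm))

/-- Two finite measurable partitions of `Ω` with almost the same measures are almost mapped
to each other by some element of `Aut(Ω)`. -/
theorem exists_aut_index_ne_le (n : ℕ) (a b : Ω → ℕ) (ha : Measurable a) (hb : Measurable b)
    (han : ∀ ω, a ω ≤ n) (hbn : ∀ ω, b ω ≤ n) :
    ∃ s : AutΩ, volume {ω | b (s.toFun ω) ≠ a ω} ≤ ∑ m ∈ Finset.range n,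
      ENNReal.ofReal |volume.real {ω | a ω ≤ m} - volume.real {ω | b ω ≤ m}| := by
  obtain ⟨t, c, hc, ht1, ht2⟩ := exists_aut_consecutive a ha
  obtain ⟨u, d, hd, hu1, hu2⟩ := exists_aut_consecutive b hb
  refine ⟨u⁻¹ * t, ?_⟩
  have hs : ∀ᵐ ω : Ω, u.toFun ((u⁻¹ * t).toFun ω) = t.toFun ω := by
    filter_upwards [AutΩ.mul_ae u⁻¹ t,
      t.measurePreserving.quasiMeasurePreserving.ae u.apply_inv_ae] with ω h1 h2
    rw [h1, h2]
  have hcm : Monotone c := fun m m' h => by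
    refine Subtype.coe_le_coe.1 ?_
    rw [hc, hc]
    exact measureReal_mono fun ω h' => le_trans h' h
  have hdm : Monotone d := fun m m' h => by
    refine Subtype.coe_le_coe.1 ?_
    rw [hd, hd]
    exact measureReal_mono fun ω h' => le_trans h' h
  -- Both partitions become consecutive intervals, with right endpoints `c m` and `d m`. If the
  -- indices of `ω` and its image differ, the common image point lies between `c m` and `d m` for
  -- `m` the smaller of the two indices.
  have hsub : {ω | b ((u⁻¹ * t).toFun ω) ≠ a ω} ≤ᵐ[volume]
      t.toFun ⁻¹' (⋃ m ∈ Finset.range n, uIcc (c m) (d m)) := by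
    have hq := (u⁻¹ * t).measurePreserving.quasiMeasurePreserving
    filter_upwards [hs, ht1, ht2, hq.ae hu1, hq.ae hu2] with ω h h1 h2 h3 h4
    intro hne
    rw [h] at h3 h4
    suffices ∃ m < n, t.toFun ω ∈ uIcc (c m) (d m) by
      obtain ⟨m, hm, h5⟩ := this
      exact mem_biUnion (Finset.mem_coe.2 (Finset.mem_range.2 hm)) h5
    rcases lt_or_gt_of_ne hne with hlt | hlt
    · refine ⟨b ((u⁻¹ * t).toFun ω), lt_of_lt_of_le hlt (han ω), ?_⟩
      exact Icc_subset_uIcc ⟨h2 _ hlt, h3⟩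
    · refine ⟨a ω, lt_of_lt_of_le hlt (hbn _), ?_⟩
      exact Icc_subset_uIcc' ⟨h4 _ hlt, h1⟩
  refine (measure_mono_ae hsub).trans ?_
  rw [t.measurePreserving.measure_preimage
    (MeasurableSet.nullMeasurableSet (Finset.measurableSet_biUnion _ fun m _ => measurableSet_uIcc))]
  refine (measure_biUnion_finset_le _ _).trans (Finset.sum_le_sum fun m _ => ?_)
  rw [unitInterval.volume_uIcc, edist_comm, edist_dist, Subtype.dist_eq, hc, hd, Real.dist_eq]

/-! ### Random variables with close laws -/

theorem measure_frontier_biUnion_eq_zero {P : Type*} [TopologicalSpace P] [MeasurableSpace P]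
    (l : Measure P) (O : ℕ → Set P) (hO : ∀ i, l (frontier (O i)) = 0) (m : ℕ) :
    l (frontier (⋃ i ≤ m, O i)) = 0 := by
  induction m with
  | zero => simpa using hO 0
  | succ m ih =>
    have h : (⋃ i ≤ m + 1, O i) = (⋃ i ≤ m, O i) ∪ O (m + 1) := by
      ext x
      simp only [mem_iUnion, mem_union, Nat.le_succ_iff, exists_prop, or_and_right, exists_or,
        exists_eq_left]
    rw [h]
    exact measure_mono_null (frontier_union_subset _ _) (measure_union_null
      (measure_mono_null inter_subset_left ih) (measure_mono_null inter_subset_right (hO _)))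

/-- A compact space with a probability measure has a finite partition into small pieces, given by a
measurable index function whose sublevel sets have null frontiers. -/
theorem exists_index_null_frontier {P : Type*} [UniformSpace P] [(uniformity P).IsCountablyGenerated]
    [CompactSpace P] [MeasurableSpace P] [BorelSpace P] (l : Measure P) [IsProbabilityMeasure l]
    {E : Set (P × P)} (hE : E ∈ uniformity P) :
    ∃ (n : ℕ) (a : P → ℕ), Measurable a ∧ (∀ p, a p ≤ n) ∧
      (∀ m, l (frontier {p | a p ≤ m}) = 0) ∧ ∀ p q, a p = a q → (p, q) ∈ E := by
  classical
  let := UniformSpace.pseudoMetricSpace P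
  obtain ⟨δ, hδ, hδE⟩ := Metric.mem_uniformity_dist.1 hE
  have hball : ∀ x : P, ∃ r ∈ Ioo 0 (δ / 2), l (frontier (Metric.ball x r)) = 0 := by
    intro x
    -- Frontiers for distinct radii are disjoint, so only countably many of them can be charged by
    -- `l`.
    obtain ⟨r, hr, h⟩ := exists_null_frontier_thickening l {x} (half_pos hδ)
    exact ⟨r, hr, by rwa [Metric.thickening_singleton] at h⟩
  choose r hr hr0 using hball
  obtain ⟨t, ht⟩ := isCompact_univ.elim_nhds_subcover (fun x => Metric.ball x (r x))
    fun x _ => Metric.ball_mem_nhds x (hr x).1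
  -- The finite cover, listed as a sequence that is empty past its end. The index of a point is that
  -- of the first ball containing it, so its sublevel sets are finite unions of balls.
  let O : ℕ → Set P := fun i => if h : i < t.card then
    Metric.ball (t.equivFin.symm ⟨i, h⟩ : P) (r (t.equivFin.symm ⟨i, h⟩)) else ∅
  have hO : ∀ i, IsOpen (O i) := by
    intro i
    by_cases h : i < t.card
    · simp only [O, h, dite_true]; exact Metric.isOpen_ball
    · simp only [O, h, dite_false]; exact isOpen_empty
  have hO0 : ∀ i, l (frontier (O i)) = 0 := by
    intro i
    by_cases h : i < t.card
    · simp only [O, h, dite_true]; exact hr0 _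
    · simp [O, h]
  have hOE : ∀ i, ∀ p ∈ O i, ∀ q ∈ O i, (p, q) ∈ E := by
    intro i p hp q hq
    by_cases h : i < t.card
    · simp only [O, h, dite_true, Metric.mem_ball] at hp hq
      refine hδE ?_
      have h1 := (hr (t.equivFin.symm ⟨i, h⟩)).2
      have h2 := dist_triangle_right p q (t.equivFin.symm ⟨i, h⟩)
      linarith
    · simp [O, h] at hp
  have hex' : ∀ p, ∃ i < t.card, p ∈ O i := by
    intro p
    obtain ⟨x, hx, hpx⟩ := mem_iUnion₂.1 (ht.2 (mem_univ p))
    refine ⟨t.equivFin ⟨x, hx⟩, (t.equivFin ⟨x, hx⟩).2, ?_⟩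
    simpa [O] using hpx
  have hex : ∀ p, ∃ i, p ∈ O i := fun p => (hex' p).imp fun _ h => h.2
  refine ⟨t.card, fun p => Nat.find (hex p), measurable_find hex fun i => (hO i).measurableSet,
    fun p => ?_, fun m => ?_, fun p q h => ?_⟩
  · obtain ⟨i, hi, hpi⟩ := hex' p
    exact (Nat.find_min' (hex p) hpi).trans hi.le
  · have : {p | Nat.find (hex p) ≤ m} = ⋃ i ≤ m, O i := by
      ext p
      simp [Nat.find_le_iff]
    rw [this]
    exact measure_frontier_biUnion_eq_zero l O hO0 m
  · refine hOE (Nat.find (hex p)) p (Nat.find_spec (hex p)) q ?_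
    simp only at h
    rw [h]
    exact Nat.find_spec (hex q)

/-- Two random variables on `Ω` with values in a compact space whose laws are close to each other
are close to each other in measure, up to an element of `Aut(Ω)`. -/
theorem exists_nhds_forall_exists_aut {P : Type*} [UniformSpace P]
    [(uniformity P).IsCountablyGenerated]
    [CompactSpace P] [MeasurableSpace P] [BorelSpace P] (l : ProbabilityMeasure P)
    {E : Set (P × P)} (hE : E ∈ uniformity P) {ε : ℝ} (hε : 0 < ε) :
    ∃ N ∈ 𝓝 l, ∀ p q : Ω → P, Measurable p → Measurable q → ∀ lp ∈ N, ∀ lq ∈ N,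
      (lp : Measure P) = volume.map p → (lq : Measure P) = volume.map q →
      ∃ s : AutΩ, volume {ω | (p ω, q (s.toFun ω)) ∉ E} ≤ ENNReal.ofReal ε := by
  obtain ⟨n, a, ha, han, ha0, haE⟩ := exists_index_null_frontier (l : Measure P) hE
  let := UniformSpace.pseudoMetricSpace P
  -- Each of the `n` sublevel sets contributes a discrepancy of at most `2η`, and `n * 2η ≤ ε`; the
  -- `+ 1` covers `n = 0`.
  let η : ℝ := ε / (2 * (n + 1))
  have hη : 0 < η := by positivity
  refine ⟨{l' | ∀ m ∈ Finset.range n, |(l' : Measure P).real {p | a p ≤ m} -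
    (l : Measure P).real {p | a p ≤ m}| < η}, ?_, ?_⟩
  · change ∀ᶠ l' in 𝓝 l, _
    rw [Finset.eventually_all]
    intro m _
    have h1 := ProbabilityMeasure.tendsto_measure_of_null_frontier_of_tendsto'
      (tendsto_id (x := 𝓝 l)) (ha0 m)
    have h2 := (ENNReal.tendsto_toReal (measure_ne_top (l : Measure P) _)).comp h1
    exact (Metric.tendsto_nhds.1 h2) η hη
  · intro p q hp hq lp hlp lq hlq hlp' hlq'
    obtain ⟨s, hs⟩ := exists_aut_index_ne_le n (a ∘ p) (a ∘ q) (ha.comp hp) (ha.comp hq)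
      (fun _ => han _) (fun _ => han _)
    refine ⟨s, (measure_mono (t := {ω | (a ∘ q) (s.toFun ω) ≠ (a ∘ p) ω})
      (ofPred_subset_ofPred.2 fun ω hω h => hω (haE _ _ h.symm))).trans (hs.trans ?_)⟩
    calc _ ≤ ∑ m ∈ Finset.range n, ENNReal.ofReal (2 * η) := by
          refine Finset.sum_le_sum fun m hm => ENNReal.ofReal_le_ofReal ?_
          have h1 := hlp m hm
          have h2 := hlq m hm
          have hms : MeasurableSet {p | a p ≤ m} := measurableSet_le ha measurable_const
          rw [hlp', map_measureReal_apply hp hms] at h1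
          rw [hlq', map_measureReal_apply hq hms] at h2
          rw [abs_lt] at h1 h2
          refine abs_le.2 ⟨?_, ?_⟩
          · have := h1.1; have := h2.2
            simp only [preimage_ofPred_eq] at *
            simp only [Function.comp_apply]
            linarith
          · have := h1.2; have := h2.1
            simp only [preimage_ofPred_eq] at *
            simp only [Function.comp_apply]
            linarith
      _ ≤ ENNReal.ofReal ε := by
          rw [Finset.sum_const, Finset.card_range, ← ENNReal.ofReal_nsmul]
          refine ENNReal.ofReal_le_ofReal ?_
          rw [nsmul_eq_mul]
          have : ε = 2 * η * (n + 1) := by simp only [η]; field_simp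
          nlinarith

/-! ### The topologies of `L⁰(Ω, X)` and `Aut(Ω)` as convergence in measure -/

namespace L0

theorem continuous_id_of_tendsto_seq {X : Type*} (t t' : TopologicalSpace X)
    [@FirstCountableTopology X t]
    (h : ∀ (f : ℕ → X) (g : X), Tendsto f atTop (@nhds X t g) → Tendsto f atTop (@nhds X t' g)) :
    t ≤ t' := by
  refine continuous_id_iff_le.1 ((@continuous_iff_continuousAt X X t t' id).2 fun g => ?_)
  have := @FirstCountableTopology.nhds_generated_countable X t _ g
  exact tendsto_of_seq_tendsto fun f hf => h f g hf

/-- The instance is built from a chosen metric, but the subsequence criterion for convergence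
mentions only the topology of `X`. Both topologies are first countable, so having the same
convergent sequences makes them equal, and any compatible metric may be used. -/
theorem topology_eq {X : Type*} [MetricSpace X] : (instTopologicalSpace : TopologicalSpace (L0 X)) =
    (pseudoEMetricSpace X).toUniformSpace.toTopologicalSpace := by
  have h : ∀ (f : ℕ → L0 X) (g : L0 X), Tendsto f atTop (𝓝 g) ↔ Tendsto f atTop
      (@nhds _ (pseudoEMetricSpace X).toUniformSpace.toTopologicalSpace g) := fun f g =>
    tendsto_iff.trans tendsto_iff_metric.symm
  refine le_antisymm ?_ ?_
  · exact continuous_id_of_tendsto_seq _ _ fun f g => (h f g).1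
  · let := pseudoEMetricSpace X
    exact @continuous_id_of_tendsto_seq _ (pseudoEMetricSpace X).toUniformSpace.toTopologicalSpace
      _ (@UniformSpace.firstCountableTopology (L0 X) (pseudoEMetricSpace X).toUniformSpace
        (@EMetric.instIsCountablyGeneratedUniformity (L0 X) (pseudoEMetricSpace X))) fun f g => (h f g).2

/-- The topology of `L⁰(Ω, X)` is that of convergence in measure. -/
theorem hasBasis_nhds {X : Type*} [MetricSpace X] (f : L0 X) :
    (𝓝 f).HasBasis (fun ε : ℝ => 0 < ε) fun ε =>
      {g | volume {ω : Ω | ε ≤ dist (g ω) (f ω)} ≤ ENNReal.ofReal ε} := by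
  have hm : ∀ g : L0 X, Measurable fun ω => min 1 (edist (g ω) (f ω)) := fun g =>
    measurable_const.min (g.stronglyMeasurable.edist f.stronglyMeasurable).measurable
  have hd : ∀ g : L0 X, Measurable fun ω => dist (g ω) (f ω) := fun g =>
    (g.stronglyMeasurable.dist f.stronglyMeasurable).measurable
  rw [topology_eq]
  let := pseudoEMetricSpace X
  refine Metric.nhds_basis_eball.to_hasBasis (fun e he => ?_) (fun ε hε => ?_)
  · obtain ⟨ε, hε, hεe⟩ : ∃ ε : ℝ, 0 < ε ∧ ENNReal.ofReal ε + ENNReal.ofReal ε < e := by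
      have h : Tendsto (fun ε : ℝ => ENNReal.ofReal ε + ENNReal.ofReal ε) (𝓝[>] 0) (𝓝 0) := by
        have h1 : Continuous fun ε : ℝ => ENNReal.ofReal ε + ENNReal.ofReal ε :=
          ENNReal.continuous_ofReal.add ENNReal.continuous_ofReal
        have := h1.tendsto 0
        simp only [ENNReal.ofReal_zero, add_zero] at this
        exact this.mono_left nhdsWithin_le_nhds
      obtain ⟨ε, h1, h2⟩ := ((h.eventually (gt_mem_nhds he)).and self_mem_nhdsWithin).exists
      exact ⟨ε, h2, h1⟩
    refine ⟨ε, hε, fun g hg => ?_⟩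
    have hg' : volume {ω : Ω | ε ≤ dist (g ω) (f ω)} ≤ ENNReal.ofReal ε := hg
    change ∫⁻ ω, min 1 (edist (g ω) (f ω)) < e
    refine lt_of_le_of_lt ?_ hεe
    have hms : MeasurableSet {ω : Ω | ε ≤ dist (g ω) (f ω)} :=
      measurableSet_le measurable_const (hd g)
    calc ∫⁻ ω, min 1 (edist (g ω) (f ω))
        ≤ ∫⁻ ω, ({ω : Ω | ε ≤ dist (g ω) (f ω)}.indicator 1 ω + ENNReal.ofReal ε) := by
          refine lintegral_mono fun ω => ?_
          by_cases h : ε ≤ dist (g ω) (f ω)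
          · refine (min_le_left _ _).trans ?_
            simp [h]
          · refine (min_le_right _ _).trans (le_add_left ?_)
            rw [edist_dist]
            exact ENNReal.ofReal_le_ofReal (not_le.1 h).le
      _ = volume {ω : Ω | ε ≤ dist (g ω) (f ω)} + ENNReal.ofReal ε := by
          rw [lintegral_add_right _ measurable_const, lintegral_indicator_one hms]
          simp
      _ ≤ _ := by gcongr
  · have hε' : (0 : ℝ) < min 1 ε := by positivity
    refine ⟨ENNReal.ofReal (ε * min 1 ε), ENNReal.ofReal_pos.2 (mul_pos hε hε'), fun g hg => ?_⟩
    have hg' : ∫⁻ ω, min 1 (edist (g ω) (f ω)) < ENNReal.ofReal (ε * min 1 ε) := hg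
    change volume _ ≤ _
    calc volume {ω : Ω | ε ≤ dist (g ω) (f ω)}
        ≤ volume {ω : Ω | ENNReal.ofReal (min 1 ε) ≤ min 1 (edist (g ω) (f ω))} := by
          refine measure_mono fun ω hω => ?_
          have hω' : ε ≤ dist (g ω) (f ω) := hω
          change _ ≤ min 1 (edist (g ω) (f ω))
          refine le_min ?_ ?_
          · exact ENNReal.ofReal_le_one.2 (min_le_left _ _)
          · rw [edist_dist]
            exact ENNReal.ofReal_le_ofReal ((min_le_right _ _).trans hω')
      _ ≤ (∫⁻ ω, min 1 (edist (g ω) (f ω))) / ENNReal.ofReal (min 1 ε) :=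
          meas_ge_le_lintegral_div (hm g).aemeasurable (by simpa using hε) (by simp)
      _ ≤ ENNReal.ofReal (ε * min 1 ε) / ENNReal.ofReal (min 1 ε) := by gcongr
      _ = ENNReal.ofReal ε := by
          rw [← ENNReal.ofReal_div_of_pos hε', mul_div_cancel_right₀ _ hε'.ne']

/-- With `exists_forall_mem_of_mem_nhds_one`, this describes the neighbourhoods of `1` in `L⁰(Ω, G)`
through those of `1` in `G`, with no metric in sight. -/
theorem eventually_measure_notMem_le {G : Type*} [Group G] [TopologicalSpace G]
    [IsTopologicalGroup G] [TopologicalSpace.MetrizableSpace G] {V : Set G} (hV : V ∈ 𝓝 (1 : G))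
    {ε : ℝ} (hε : 0 < ε) :
    ∀ᶠ h : L0 G in 𝓝 1, volume {ω : Ω | h ω ∉ V} ≤ ENNReal.ofReal ε := by
  let := TopologicalSpace.metrizableSpaceMetric G
  obtain ⟨δ, hδ, hδV⟩ := Metric.mem_nhds_iff.1 hV
  filter_upwards [(hasBasis_nhds (1 : L0 G)).mem_of_mem (lt_min hδ hε)] with h hh
  have hh' : volume {ω : Ω | min δ ε ≤ dist (h ω) ((1 : L0 G) ω)} ≤ ENNReal.ofReal (min δ ε) := hh
  refine (measure_mono_ae ?_).trans (hh'.trans (ENNReal.ofReal_le_ofReal (min_le_right _ _)))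
  filter_upwards [AEEqFun.coeFn_one (α := Ω) (μ := volume) (β := G)] with ω h1 (h2 : h ω ∉ V)
  change min δ ε ≤ _
  by_contra! h3
  rw [h1] at h3
  exact h2 (hδV (h3.trans_le (min_le_left _ _)))

theorem exists_forall_mem_of_mem_nhds_one {G : Type*} [Group G] [TopologicalSpace G]
    [IsTopologicalGroup G] [TopologicalSpace.MetrizableSpace G] {U : Set (L0 G)}
    (hU : U ∈ 𝓝 (1 : L0 G)) : ∃ V ∈ 𝓝 (1 : G), IsOpen V ∧ ∃ ε : ℝ, 0 < ε ∧
      ∀ h : L0 G, volume {ω : Ω | h ω ∉ V} ≤ ENNReal.ofReal ε → h ∈ U := by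
  let := TopologicalSpace.metrizableSpaceMetric G
  obtain ⟨ε, hε, hεU⟩ := (hasBasis_nhds (1 : L0 G)).mem_iff.1 hU
  refine ⟨Metric.ball 1 ε, Metric.ball_mem_nhds _ hε, Metric.isOpen_ball, ε, hε,
    fun h hh => hεU ?_⟩
  refine (measure_mono_ae ?_).trans hh
  filter_upwards [AEEqFun.coeFn_one (α := Ω) (μ := volume) (β := G)] with ω h1
    (h2 : ε ≤ dist (h ω) ((1 : L0 G) ω))
  rw [h1] at h2
  exact fun h3 => absurd h2 (not_le.2 h3)

end L0

namespace AutΩ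

/-- The identity of `Ω = [0,1]` is itself one of the test functions defining the topology of
`Aut(Ω)`, and `s⁻¹` sends it to `s`. -/
theorem eventually_measure_dist_le {ε : ℝ} (hε : 0 < ε) :
    ∀ᶠ s : AutΩ in 𝓝 1, volume {ω : Ω | ε ≤ dist (s.toFun ω) ω} ≤ ENNReal.ofReal ε := by
  let r : L0 Ω := AEEqFun.mk id aestronglyMeasurable_id
  have hr : ∀ᵐ ω : Ω, r ω = ω := AEEqFun.coeFn_mk _ _
  have h1 : Tendsto (fun s : AutΩ => s⁻¹.act r) (𝓝 1) (𝓝 r) := by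
    have := ((continuous_act_left r).comp continuous_inv).tendsto 1
    simpa only [Function.comp_def, inv_one, one_act] using this
  filter_upwards [h1 ((L0.hasBasis_nhds r).mem_of_mem hε)] with s hs
  refine (measure_mono_ae ?_).trans hs
  filter_upwards [act_ae s⁻¹ r, hr, s.measurePreserving.quasiMeasurePreserving.ae hr]
    with ω h2 h3 h4 (h5 : ε ≤ dist (s.toFun ω) ω)
  change ε ≤ _
  rwa [h2, inv_inv, h3, h4]

theorem measure_dist_inv (s : AutΩ) (ε : ℝ) :
    volume {ω : Ω | ε ≤ dist (s⁻¹.toFun ω) ω} = volume {ω : Ω | ε ≤ dist (s.toFun ω) ω} := by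
  have hm : MeasurableSet {ω : Ω | ε ≤ dist (s⁻¹.toFun ω) ω} := measurableSet_le measurable_const
    (s⁻¹.measurePreserving.measurable.dist measurable_id)
  rw [← s.measurePreserving.measure_preimage hm.nullMeasurableSet]
  refine measure_congr ?_
  filter_upwards [s.inv_apply_ae] with ω h
  refine propext ?_
  change ε ≤ dist (s⁻¹.toFun (s.toFun ω)) (s.toFun ω) ↔ ε ≤ dist (s.toFun ω) ω
  rw [h, dist_comm]

theorem exists_continuous_measure_dist_le (r : L0 unitInterval) {ε : ℝ} (hε : 0 < ε) :
    ∃ c : C(Ω, ℝ), volume {ω : Ω | ε ≤ |(r ω : ℝ) - c ω|} ≤ ENNReal.ofReal ε := by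
  have hrm : Measurable fun ω : Ω => (r ω : ℝ) :=
    measurable_subtype_coe.comp r.stronglyMeasurable.measurable
  have hr : Integrable (fun ω : Ω => (r ω : ℝ)) volume :=
    Integrable.of_bound hrm.aestronglyMeasurable 1 (ae_of_all _ fun ω => by
      rw [Real.norm_of_nonneg (r ω).2.1]; exact (r ω).2.2)
  -- An `L¹` error of `ε²` becomes a measure bound of `ε` by Markov's inequality.
  obtain ⟨c, hc, -⟩ := hr.exists_boundedContinuous_lintegral_sub_le
    (ε := ENNReal.ofReal (ε * ε)) (ENNReal.ofReal_pos.2 (mul_pos hε hε)).ne'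
  refine ⟨c.toContinuousMap, ?_⟩
  calc volume {ω : Ω | ε ≤ |(r ω : ℝ) - c ω|}
      ≤ volume {ω : Ω | ENNReal.ofReal ε ≤ ‖(r ω : ℝ) - c ω‖ₑ} := by
        refine measure_mono fun ω hω => ?_
        change ENNReal.ofReal ε ≤ _
        rw [Real.enorm_eq_ofReal_abs]
        exact ENNReal.ofReal_le_ofReal hω
    _ ≤ (∫⁻ ω, ‖(r ω : ℝ) - c ω‖ₑ) / ENNReal.ofReal ε :=
        meas_ge_le_lintegral_div (hrm.sub c.continuous.measurable).enorm.aemeasurable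
          (by simpa using hε) (by simp)
    _ ≤ ENNReal.ofReal (ε * ε) / ENNReal.ofReal ε := by gcongr
    _ = ENNReal.ofReal ε := by
        rw [← ENNReal.ofReal_div_of_pos hε, mul_div_cancel_right₀ _ hε.ne']

/-- Replace `r` by a continuous `c` up to a set of small measure. Uniform continuity of `c` handles
the displacement by `s⁻¹`, and the error set pulled back by `s⁻¹` keeps its measure. This gives
three errors of `ε / 3`. -/
theorem exists_forall_act_close (r : L0 unitInterval) {ε : ℝ} (hε : 0 < ε) :
    ∃ δ : ℝ, 0 < δ ∧ ∀ s : AutΩ, volume {ω : Ω | δ ≤ dist (s.toFun ω) ω} ≤ ENNReal.ofReal δ →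
      volume {ω : Ω | ε ≤ dist (s.act r ω) (r ω)} ≤ ENNReal.ofReal ε := by
  have hε3 : 0 < ε / 3 := by positivity
  obtain ⟨c, hc⟩ := exists_continuous_measure_dist_le r hε3
  obtain ⟨δ, hδ, hδc⟩ := Metric.uniformContinuous_iff.1
    (CompactSpace.uniformContinuous_of_continuous c.continuous) (ε / 3) hε3
  refine ⟨min δ (ε / 3), by positivity, fun s hs => ?_⟩
  have hrm : Measurable fun ω : Ω => (r ω : ℝ) :=
    measurable_subtype_coe.comp r.stronglyMeasurable.measurable
  have hm : MeasurableSet {ω : Ω | ε / 3 ≤ |(r ω : ℝ) - c ω|} :=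
    measurableSet_le measurable_const (hrm.sub c.continuous.measurable).abs
  rw [← measure_dist_inv] at hs
  calc volume {ω : Ω | ε ≤ dist (s.act r ω) (r ω)}
      ≤ volume ((s⁻¹.toFun ⁻¹' {ω : Ω | ε / 3 ≤ |(r ω : ℝ) - c ω|} ∪
          {ω : Ω | ε / 3 ≤ |(r ω : ℝ) - c ω|}) ∪
          {ω : Ω | min δ (ε / 3) ≤ dist (s⁻¹.toFun ω) ω}) := by
        refine measure_mono_ae ?_
        filter_upwards [act_ae s r] with ω h1 (h2 : ε ≤ dist (s.act r ω) (r ω))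
        by_contra h3
        change ¬ ((_ ∨ _) ∨ _) at h3
        push Not at h3
        obtain ⟨⟨h4, h5⟩, h6⟩ := h3
        have h4 : ¬ (ε / 3 ≤ |(r (s⁻¹.toFun ω) : ℝ) - c (s⁻¹.toFun ω)|) := h4
        have h5 : ¬ (ε / 3 ≤ |(r ω : ℝ) - c ω|) := h5
        have h6 : ¬ (min δ (ε / 3) ≤ dist (s⁻¹.toFun ω) ω) := h6
        have h7 := hδc ((not_le.1 h6).trans_le (min_le_left _ _))
        rw [Real.dist_eq] at h7
        rw [h1, Subtype.dist_eq, Real.dist_eq] at h2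
        rw [not_le, abs_lt] at h4 h5
        rw [abs_lt] at h7
        refine absurd h2 (not_le.2 (abs_lt.2 ⟨?_, ?_⟩)) <;> linarith [h4.1, h4.2, h5.1, h5.2, h7.1, h7.2]
    _ ≤ (ENNReal.ofReal (ε / 3) + ENNReal.ofReal (ε / 3)) + ENNReal.ofReal (ε / 3) := by
        refine (measure_union_le _ _).trans (add_le_add ((measure_union_le _ _).trans
          (add_le_add ?_ hc)) (hs.trans (ENNReal.ofReal_le_ofReal (min_le_right _ _))))
        rw [s⁻¹.measurePreserving.measure_preimage hm.nullMeasurableSet]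
        exact hc
    _ = ENNReal.ofReal ε := by
        rw [← ENNReal.ofReal_add hε3.le hε3.le, ← ENNReal.ofReal_add (by positivity) hε3.le]
        congr 1; ring

/-- Converse of `eventually_measure_dist_le`: a neighbourhood of `1` involves finitely many test
functions, and `exists_forall_act_close` treats each of them. -/
theorem exists_forall_mem_of_mem_nhds_one {U : Set AutΩ} (hU : U ∈ 𝓝 (1 : AutΩ)) :
    ∃ ε : ℝ, 0 < ε ∧
      ∀ s : AutΩ, volume {ω : Ω | ε ≤ dist (s.toFun ω) ω} ≤ ENNReal.ofReal ε → s ∈ U := by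
  rw [nhds_induced] at hU
  obtain ⟨W, hW, hWU⟩ := mem_comap.1 hU
  rw [nhds_pi] at hW
  obtain ⟨I, hI, t, ht, htW⟩ := Filter.mem_pi.1 hW
  -- The condition gets stronger as `δ` decreases, so it holds for all small `δ` and the finitely
  -- many `r` can share one.
  have key : ∀ r : L0 unitInterval, ∀ᶠ δ : ℝ in 𝓝[>] 0, ∀ s : AutΩ,
      volume {ω : Ω | δ ≤ dist (s.toFun ω) ω} ≤ ENNReal.ofReal δ → s.act r ∈ t r := by
    intro r
    have htr := ht r
    rw [one_act] at htr
    obtain ⟨ε, hε, hεt⟩ := (L0.hasBasis_nhds r).mem_iff.1 htr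
    obtain ⟨δ, hδ, h⟩ := exists_forall_act_close r hε
    filter_upwards [Ioc_mem_nhdsGT hδ] with δ' hδ' s hs
    refine hεt (h s ?_)
    exact (measure_mono (ofPred_subset_ofPred.2 fun ω hω => hδ'.2.trans hω)).trans
      (hs.trans (ENNReal.ofReal_le_ofReal hδ'.2))
  obtain ⟨δ, hδ, hδ0⟩ := (((eventually_all_finite hI).2 fun r _ => key r).and
    self_mem_nhdsWithin).exists
  exact ⟨δ, hδ0, fun s hs => hWU (htW fun r hr => hδ r hr s hs)⟩

end AutΩ

/-! ### Compactness of `𝓜(Ω, K)` and continuity of each translation -/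

namespace Markov

section Topology

variable {K : Type*} [TopologicalSpace K] [MeasurableSpace K] [BorelSpace K] [PolishSpace K]

/-- The topology of `𝓜(Ω, K)` is induced by the integration of continuous functions. -/
theorem isInducing_integral : IsInducing fun (l : Markov K)
    (f : BoundedContinuousFunction (Ω × K × Ω) ℝ) => ∫ p, f p ∂l.toMeasure := by
  refine isInducing_iff_nhds.2 fun l => ?_
  let ev : Markov K → BoundedContinuousFunction (Ω × K × Ω) ℝ → ℝ :=
    fun l f => ∫ p, f p ∂l.toMeasure
  change 𝓝 l = comap ev (𝓝 (ev l))
  refine le_antisymm (tendsto_iff_comap.1 (tendsto_pi_nhds.2 fun f => ?_)) ?_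
  · have h : Tendsto (fun l' : Markov K => l'.1) (𝓝 l) (𝓝 l.1) := continuous_subtype_val.tendsto l
    exact ProbabilityMeasure.tendsto_iff_forall_integral_tendsto.1 h f
  · suffices Tendsto (fun l' : Markov K => l') (comap ev (𝓝 (ev l))) (𝓝 l) from this
    refine tendsto_subtype_rng.2 (ProbabilityMeasure.tendsto_iff_forall_integral_tendsto.2
      fun f => ?_)
    have h : Tendsto ev (comap ev (𝓝 (ev l))) (𝓝 (ev l)) := tendsto_comap
    exact tendsto_pi_nhds.1 h f

instance instT2Space : T2Space (Markov K) :=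
  inferInstanceAs (T2Space {l : ProbabilityMeasure (Ω × K × Ω) //
    (l : Measure (Ω × K × Ω)).map (fun p => p.1) = volume ∧
    (l : Measure (Ω × K × Ω)).map (fun p => p.2.2) = volume})

theorem isEmbedding_integral : IsEmbedding fun (l : Markov K)
    (f : BoundedContinuousFunction (Ω × K × Ω) ℝ) => ∫ p, f p ∂l.toMeasure :=
  ⟨isInducing_integral, isInducing_integral.injective⟩

/-- The uniformity on `𝓜(Ω, K)` induced by the integration of continuous functions. -/
abbrev uniformSpace : UniformSpace (Markov K) :=
  IsEmbedding.comapUniformSpace _ (isEmbedding_integral (K := K))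

theorem continuous_integral (f : BoundedContinuousFunction (Ω × K × Ω) ℝ) :
    Continuous fun l : Markov K => ∫ p, f p ∂l.toMeasure :=
  (continuous_apply f).comp isInducing_integral.continuous

/-- The marginal maps are weak-* continuous, so fixing both marginals cuts out a closed subset of
the compact space of probability measures on `Ω × K × Ω`. -/
instance instCompactSpace [CompactSpace K] : CompactSpace (Markov K) := by
  refine (isCompact_iff_compactSpace (s := {l : ProbabilityMeasure (Ω × K × Ω) |
    (l : Measure (Ω × K × Ω)).map (fun p => p.1) = volume ∧
    (l : Measure (Ω × K × Ω)).map (fun p => p.2.2) = volume})).1 (IsClosed.isCompact ?_)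
  let μ : ProbabilityMeasure Ω := ⟨volume, inferInstance⟩
  have h1 : Measurable fun p : Ω × K × Ω => p.1 := measurable_fst
  have h2 : Measurable fun p : Ω × K × Ω => p.2.2 := measurable_snd.snd
  have c1 : Continuous fun l : ProbabilityMeasure (Ω × K × Ω) => l.map h1.aemeasurable :=
    ProbabilityMeasure.continuous_map continuous_fst
  have c2 : Continuous fun l : ProbabilityMeasure (Ω × K × Ω) => l.map h2.aemeasurable :=
    ProbabilityMeasure.continuous_map continuous_snd.snd
  have h3 := (isClosed_singleton (x := μ)).preimage c1
  have h4 := (isClosed_singleton (x := μ)).preimage c2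
  convert h3.inter h4 using 1
  ext l
  simp only [mem_inter_iff, mem_preimage, mem_singleton_iff, mem_ofPred_eq]
  exact and_congr (Subtype.ext_iff (a1 := l.map h1.aemeasurable) (a2 := μ)).symm
    (Subtype.ext_iff (a1 := l.map h2.aemeasurable) (a2 := μ)).symm

/-- Integration of a measurable family of continuous functions is continuous on `𝓜(Ω, K)`. -/
theorem continuous_integral_caratheodory [CompactSpace K] (F : Ω → C(K × Ω, ℝ))
    (hF : StronglyMeasurable F) (C : ℝ) (hC : ∀ ω, ‖F ω‖ ≤ C) :
    Continuous fun l : Markov K => ∫ p, F p.1 p.2 ∂l.toMeasure := by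
  refine continuous_of_uniform_approx_of_continuous fun u hu => ?_
  obtain ⟨ε, hε, hεu⟩ := Metric.mem_uniformity_dist.1 hu
  have hFi : Integrable F volume := Integrable.of_bound hF.aestronglyMeasurable C (ae_of_all _ hC)
  -- The approximation takes place in `L¹(Ω, C(K × Ω))`. Every `l` has first marginal `volume`, so
  -- the resulting error is the same for all `l`, and the integrals converge uniformly on `𝓜(Ω, K)`.
  obtain ⟨c, hc, hci⟩ := hFi.exists_boundedContinuous_integral_sub_le (half_pos hε)
  have hcc : Continuous fun p : Ω × K × Ω => c p.1 p.2 :=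
    (c.continuous.comp continuous_fst).eval continuous_snd
  let f : BoundedContinuousFunction (Ω × K × Ω) ℝ := BoundedContinuousFunction.mkOfCompact ⟨_, hcc⟩
  refine ⟨_, continuous_integral f, fun l => hεu ?_⟩
  have hd : StronglyMeasurable fun ω => ‖F ω - c ω‖ :=
    (hF.sub c.continuous.stronglyMeasurable).norm
  have hdi : Integrable (fun p : Ω × K × Ω => ‖F p.1 - c p.1‖) l.toMeasure :=
    l.measurePreserving_fst.integrable_comp_of_integrable (hFi.sub hci).norm
  have hFm : StronglyMeasurable fun p : Ω × K × Ω => F p.1 p.2 :=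
    (continuous_fst.eval continuous_snd : Continuous fun q : C(K × Ω, ℝ) × K × Ω => q.1 q.2)
      |>.comp_stronglyMeasurable ((hF.comp_measurable measurable_fst).prodMk
        measurable_snd.stronglyMeasurable)
  have hF1 : Integrable (fun p : Ω × K × Ω => F p.1 p.2) l.toMeasure :=
    Integrable.of_bound hFm.aestronglyMeasurable C
      (ae_of_all _ fun p => ((F p.1).norm_coe_le_norm p.2).trans (hC _))
  have hf1 : Integrable (fun p : Ω × K × Ω => f p) l.toMeasure := f.integrable _
  rw [Real.dist_eq, ← integral_sub hF1 hf1]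
  calc |∫ p, (F p.1 p.2 - f p) ∂l.toMeasure| ≤ ∫ p, |F p.1 p.2 - f p| ∂l.toMeasure :=
        abs_integral_le_integral_abs
    _ ≤ ∫ p, ‖F p.1 - c p.1‖ ∂l.toMeasure := by
        refine integral_mono (hF1.sub hf1).abs hdi fun p => ?_
        exact (F p.1 - c p.1).norm_coe_le_norm p.2
    _ = ∫ ω, ‖F ω - c ω‖ := by
        rw [← l.measurePreserving_fst.map_eq, integral_map]
        · exact l.measurePreserving_fst.measurable.aemeasurable
        · exact hd.aestronglyMeasurable
    _ ≤ ε / 2 := hc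
    _ < ε := half_lt_self hε

/-- A test function composed with the action map of `x` need not be continuous, since `x` is merely
measurable in `ω₀`. It remains continuous in `(k, ω₁)`, which is what
`continuous_integral_caratheodory` requires. -/
theorem continuous_const_smul_wreath [CompactSpace K] {G : Type*} [Group G] [TopologicalSpace G]
    [IsTopologicalGroup G] [PolishSpace G] [MulAction G K] [ContinuousSMul G K] (x : Wreath G) :
    Continuous fun l : Markov K => x • l := by
  refine isInducing_integral.continuous_iff.2 (continuous_pi fun f => ?_)
  let H : C(Ω × G, C(K × Ω, ℝ)) := ContinuousMap.curry
    ⟨fun p : (Ω × G) × K × Ω => f (p.1.1, p.1.2 • p.2.1, p.2.2), by fun_prop⟩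
  let F : Ω → C(K × Ω, ℝ) := fun ω => H (x.right.toFun ω, x.left (x.right.toFun ω))
  have hF : StronglyMeasurable F := H.continuous.comp_stronglyMeasurable
    ((AEEqFun.stronglyMeasurable _).prodMk
      (x.left.stronglyMeasurable.comp_measurable x.right.measurePreserving.measurable))
  have h := continuous_integral_caratheodory F hF ‖f‖ fun ω =>
    (ContinuousMap.norm_le _ (norm_nonneg f)).2 fun y => f.norm_coe_le_norm _
  refine h.congr fun l => ?_
  change _ = ∫ p, f p ∂(l.toMeasure.map (actMap x))
  rw [integral_map (measurable_actMap x).aemeasurable f.continuous.aestronglyMeasurable]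
  rfl

end Topology

end Markov

/-! ### Expectations, entourages and the random variables of the orbit -/

/-- Continuous functions of two random variables that are close to each other in measure have almost
the same expectation. -/
theorem abs_integral_sub_integral_le {P : Type*} [TopologicalSpace P] [MeasurableSpace P]
    [BorelSpace P] (f : BoundedContinuousFunction P ℝ) {E : Set (P × P)} {ε η : ℝ} (hε : 0 ≤ ε)
    (hη : 0 ≤ η) (hE : ∀ a b, (a, b) ∈ E → |f a - f b| ≤ ε) (p q : Ω → P) (hp : Measurable p)
    (hq : Measurable q) (h : volume {ω : Ω | (p ω, q ω) ∉ E} ≤ ENNReal.ofReal η) :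
    |(∫ ω, f (p ω)) - ∫ ω, f (q ω)| ≤ ε + 2 * ‖f‖ * η := by
  have hfp : Measurable fun ω => f (p ω) := f.continuous.measurable.comp hp
  have hfq : Measurable fun ω => f (q ω) := f.continuous.measurable.comp hq
  have hip : Integrable (fun ω => f (p ω)) volume := Integrable.of_bound
    hfp.aestronglyMeasurable ‖f‖ (ae_of_all _ fun ω => f.norm_coe_le_norm _)
  have hiq : Integrable (fun ω => f (q ω)) volume := Integrable.of_bound
    hfq.aestronglyMeasurable ‖f‖ (ae_of_all _ fun ω => f.norm_coe_le_norm _)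
  -- The entourage `E` need not be measurable; `B` is a measurable set inside the exceptional one,
  -- off which the difference is at most `ε`.
  let B : Set Ω := {ω | ε < |f (p ω) - f (q ω)|}
  have hB : MeasurableSet B := measurableSet_lt measurable_const (hfp.sub hfq).abs
  have hBη : volume.real B ≤ η := by
    refine ENNReal.toReal_le_of_le_ofReal hη ((measure_mono ?_).trans h)
    exact fun ω hω hE' => absurd (hE _ _ hE') (not_le.2 hω)
  have hi : Integrable (fun ω => ε + B.indicator (fun _ => 2 * ‖f‖) ω) volume :=
    (integrable_const _).add ((integrable_const _).indicator hB)
  rw [← integral_sub hip hiq]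
  calc |∫ ω, (f (p ω) - f (q ω))| ≤ ∫ ω, |f (p ω) - f (q ω)| := abs_integral_le_integral_abs
    _ ≤ ∫ ω, (ε + B.indicator (fun _ => 2 * ‖f‖) ω) := by
        refine integral_mono (hip.sub hiq).abs hi fun ω => ?_
        by_cases hω : ω ∈ B
        · simp only [indicator_of_mem hω]
          have h1 := f.norm_coe_le_norm (p ω)
          have h2 := f.norm_coe_le_norm (q ω)
          have h3 := norm_sub_le (f (p ω)) (f (q ω))
          simp only [Real.norm_eq_abs] at h1 h2 h3
          linarith
        · simp only [indicator_of_notMem hω, add_zero]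
          exact not_lt.1 hω
    _ = ε + 2 * ‖f‖ * volume.real B := by
        rw [integral_add (integrable_const _) ((integrable_const _).indicator hB),
          integral_indicator_const _ hB]
        simp [mul_comm]
    _ ≤ ε + 2 * ‖f‖ * η := by gcongr

theorem exists_entourage_of_mem_uniformity {K : Type*} [UniformSpace K]
    {E : Set ((Ω × K × Ω) × Ω × K × Ω)} (hE : E ∈ uniformity (Ω × K × Ω)) :
    ∃ δ : ℝ, 0 < δ ∧ ∃ EK ∈ uniformity K, ∀ a b a' b' : Ω, ∀ k k' : K, dist a a' < δ →
      (k, k') ∈ EK → dist b b' < δ → ((a, k, b), (a', k', b')) ∈ E := by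
  rw [uniformity_prod, uniformity_prod, comap_inf, comap_comap, comap_comap] at hE
  obtain ⟨A, hA, B, hB, hAB⟩ := mem_inf_iff_superset.1 hE
  obtain ⟨C, hC, D, hD, hCD⟩ := mem_inf_iff_superset.1 hB
  obtain ⟨A', hA', hA⟩ := mem_comap.1 hA
  obtain ⟨C', hC', hC⟩ := mem_comap.1 hC
  obtain ⟨D', hD', hD⟩ := mem_comap.1 hD
  obtain ⟨δ, hδ, h1⟩ := Metric.mem_uniformity_dist.1 hA'
  obtain ⟨δ', hδ', h2⟩ := Metric.mem_uniformity_dist.1 hD'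
  refine ⟨min δ δ', lt_min hδ hδ', C', hC', fun a b a' b' k k' ha hk hb => ?_⟩
  refine hAB ⟨hA ?_, hCD ⟨hC ?_, hD ?_⟩⟩
  · exact h1 (ha.trans_le (min_le_left _ _))
  · exact hk
  · exact h2 (hb.trans_le (min_le_right _ _))

theorem mem_uniformity_triple {K : Type*} [UniformSpace K] {δ : ℝ} (hδ : 0 < δ) {EK : Set (K × K)}
    (hEK : EK ∈ uniformity K) : {z : (Ω × K × Ω) × Ω × K × Ω | dist z.1.1 z.2.1 < δ ∧
      (z.1.2.1, z.2.2.1) ∈ EK ∧ dist z.1.2.2 z.2.2.2 < δ} ∈ uniformity (Ω × K × Ω) := by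
  have h := Metric.dist_mem_uniformity (α := Ω) hδ
  have h1 : UniformContinuous fun p : Ω × K × Ω => p.1 := uniformContinuous_fst
  have h2 : UniformContinuous fun p : Ω × K × Ω => p.2.1 :=
    uniformContinuous_fst.comp uniformContinuous_snd
  have h3 : UniformContinuous fun p : Ω × K × Ω => p.2.2 :=
    uniformContinuous_snd.comp uniformContinuous_snd
  filter_upwards [h1 h, h2 hEK, h3 h] with z hz1 hz2 hz3
  exact ⟨hz1, hz2, hz3⟩

namespace Markov

variable {K : Type*} [TopologicalSpace K] [MeasurableSpace K] {G : Type*} [Group G]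
  [TopologicalSpace G] [IsTopologicalGroup G] [MulAction G K]

/-- The random variable `(1, g k₀, t⁻¹)`, whose law is `g t [1, k₀, 1]`. -/
def orbitVar (k₀ : K) (x : Wreath G) (ω : Ω) : Ω × K × Ω :=
  (ω, x.left ω • k₀, x.right⁻¹.toFun ω)

variable [BorelSpace K] [PolishSpace K] [ContinuousSMul G K]

theorem measurable_orbitVar (k₀ : K) (x : Wreath G) : Measurable (orbitVar k₀ x) := by
  have h : Measurable fun ω => x.left ω • k₀ := ((continuous_id.smul continuous_const :
    Continuous fun g : G => g • k₀).comp_stronglyMeasurable x.left.stronglyMeasurable).measurable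
  exact measurable_id.prodMk (h.prodMk x.right⁻¹.measurePreserving.measurable)

variable [PolishSpace G]

/-- The action turns `(ω, k₀, ω)` into `(t ω, g(t ω) k₀, ω)`, which is `orbitVar` evaluated at `t
ω`; and `t` preserves the measure. -/
theorem toMeasure_smul_base (k₀ : K) (x : Wreath G) :
    (x • base k₀ : Markov K).toMeasure = volume.map (orbitVar k₀ x) := by
  have h1 : (base k₀ : Markov K).toMeasure = volume.map fun ω => (ω, k₀, ω) := by
    refine Measure.map_congr ?_
    filter_upwards [EndΩ.one_ae, AEEqFun.coeFn_const (μ := (volume : Measure Ω)) Ω k₀] with ω h1 h2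
    rw [h1, h2]
    rfl
  have hm : Measurable fun ω : Ω => (ω, k₀, ω) := by fun_prop
  rw [toMeasure_smul, h1, Measure.map_map (measurable_actMap x) hm,
    ← x.right.measurePreserving.map_eq, Measure.map_map (measurable_orbitVar k₀ x)
      x.right.measurePreserving.measurable, x.right.measurePreserving.map_eq]
  refine Measure.map_congr ?_
  filter_upwards [x.right.inv_apply_ae] with ω h
  simp only [Function.comp_apply, actMap, orbitVar, h]

/-- The free `s` allows the variable to be reparametrized before it is compared with another one. -/
theorem integral_smul_base (k₀ : K) (x : Wreath G) (s : AutΩ)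
    (f : BoundedContinuousFunction (Ω × K × Ω) ℝ) :
    ∫ p, f p ∂(x • base k₀ : Markov K).toMeasure = ∫ ω, f (orbitVar k₀ x (s.toFun ω)) := by
  rw [toMeasure_smul_base, integral_map (measurable_orbitVar k₀ x).aemeasurable
    f.continuous.aestronglyMeasurable]
  have h : StronglyMeasurable fun ω => f (orbitVar k₀ x ω) :=
    (f.continuous.measurable.comp (measurable_orbitVar k₀ x)).stronglyMeasurable
  rw [← integral_map (φ := s.toFun) (f := fun ω => f (orbitVar k₀ x ω))
    s.measurePreserving.measurable.aemeasurable h.aestronglyMeasurable,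
    s.measurePreserving.map_eq]

end Markov

/-! ### Closeness in measure of orbit variables versus factorizations `y = u x v` -/

namespace Wreath

variable {G : Type*} [Group G] [TopologicalSpace G] [IsTopologicalGroup G] [PolishSpace G]

theorem eventually_small {V : Set G} (hV : V ∈ 𝓝 (1 : G)) {ε : ℝ} (hε : 0 < ε) :
    ∀ᶠ u : Wreath G in 𝓝 1, volume {ω : Ω | u.left ω ∉ V} ≤ ENNReal.ofReal ε ∧
      volume {ω : Ω | ε ≤ dist (u.right.toFun ω) ω} ≤ ENNReal.ofReal ε :=
  ((continuous_left.tendsto (1 : Wreath G)).eventually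
    (L0.eventually_measure_notMem_le hV hε)).and
  ((continuous_right.tendsto (1 : Wreath G)).eventually (AutΩ.eventually_measure_dist_le hε))

theorem exists_small_subset {U : Set (Wreath G)} (hU : U ∈ 𝓝 (1 : Wreath G)) :
    ∃ V ∈ 𝓝 (1 : G), IsOpen V ∧ ∃ ε : ℝ, 0 < ε ∧ ∀ u : Wreath G,
      volume {ω : Ω | u.left ω ∉ V} ≤ ENNReal.ofReal ε →
      volume {ω : Ω | ε ≤ dist (u.right.toFun ω) ω} ≤ ENNReal.ofReal ε → u ∈ U := by
  rw [nhds_induced] at hU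
  obtain ⟨W, hW, hWU⟩ := mem_comap.1 hU
  obtain ⟨A, hA, B, hB, hAB⟩ := mem_nhds_prod_iff.1 hW
  obtain ⟨V, hV, hVo, ε, hε, h1⟩ := L0.exists_forall_mem_of_mem_nhds_one hA
  obtain ⟨ε', hε', h2⟩ := AutΩ.exists_forall_mem_of_mem_nhds_one hB
  refine ⟨V, hV, hVo, min ε ε', lt_min hε hε', fun u hu1 hu2 => hWU (hAB ⟨h1 _ ?_, h2 _ ?_⟩)⟩
  · exact hu1.trans (ENNReal.ofReal_le_ofReal (min_le_left _ _))
  · exact (measure_mono (ofPred_subset_ofPred.2 fun ω hω => (min_le_right _ _).trans hω)).trans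
      (hu2.trans (ENNReal.ofReal_le_ofReal (min_le_right _ _)))

end Wreath

theorem exists_nhds_forall_mul_mul_mem {G : Type*} [Group G] [TopologicalSpace G]
    [IsTopologicalGroup G] {E : Set (RoelckeCompletion G × RoelckeCompletion G)}
    (hE : E ∈ uniformity (RoelckeCompletion G)) :
    ∃ V ∈ 𝓝 (1 : G), ∀ g, ∀ a ∈ V, ∀ b ∈ V, (toRoelcke G g, toRoelcke G (a * g * b)) ∈ E := by
  obtain ⟨V, hV, hVE⟩ := (WithRoelcke.hasBasis_uniformity G).mem_iff.1
    (UniformSpace.Completion.uniformContinuous_coe (WithRoelcke G) hE)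
  exact ⟨V, hV, fun g a ha b hb => @hVE (g, a * g * b) ⟨a, ha, b, hb, rfl⟩⟩

/-- A uniform space carries the uniformity pulled back from its completion. With
`exists_nhds_forall_mul_mul_mem`, this translates closeness in `R(G)` into factorizations in `G` and
back. -/
theorem exists_uniformity_forall_eq_mul_mul {G : Type*} [Group G] [TopologicalSpace G]
    [IsTopologicalGroup G] {V : Set G} (hV : V ∈ 𝓝 (1 : G)) :
    ∃ E ∈ uniformity (RoelckeCompletion G), ∀ g g' : G, (toRoelcke G g, toRoelcke G g') ∈ E →
      ∃ a ∈ V, ∃ b ∈ V, g' = a * g * b := by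
  have h := (WithRoelcke.hasBasis_uniformity G).mem_of_mem hV
  obtain ⟨E, hE, hEV⟩ := mem_comap.1
    ((UniformSpace.Completion.isUniformInducing_coe (WithRoelcke G)).comap_uniformity.le h)
  exact ⟨E, hE, fun g g' hg => @hEV (g, g') hg⟩

theorem smul_roelckeBase {G : Type*} [Group G] [TopologicalSpace G] [IsTopologicalGroup G] (g : G) :
    g • roelckeBase G = toRoelcke G g := by
  have := UniformSpace.Completion.coe_smul (M := G) (X := WithRoelcke G) g (WithRoelcke.of 1)
  refine this.symm.trans ?_
  change toRoelcke G (g * 1) = _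
  rw [mul_one]

/-- Stated for arbitrary `S`, since the exceptional sets come from neighbourhoods and entourages
that need not be measurable. -/
theorem AutΩ.measure_preimage_le (t : AutΩ) (S : Set Ω) :
    volume (t.toFun ⁻¹' S) ≤ volume S := by
  conv_rhs => rw [← t.measurePreserving.map_eq]
  exact Measure.le_map_apply t.measurePreserving.measurable.aemeasurable S

namespace Wreath

variable {G : Type*} [Group G] [TopologicalSpace G] [IsTopologicalGroup G]

/-- Evaluating at `u ω` cancels the shift that `u` imposes on the components of `x` and `v`. -/
theorem mul_mul_ae (u x v : Wreath G) : ∀ᵐ ω : Ω,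
    (u * x * v).left (u.right.toFun ω) =
      u.left (u.right.toFun ω) * x.left ω * v.left (x.right⁻¹.toFun ω) ∧
    (u * x * v).right⁻¹.toFun (u.right.toFun ω) = v.right⁻¹.toFun (x.right⁻¹.toFun ω) := by
  have hu := u.right.measurePreserving.quasiMeasurePreserving
  have hui := u.right⁻¹.measurePreserving.quasiMeasurePreserving
  have hxi := x.right⁻¹.measurePreserving.quasiMeasurePreserving
  have h1 : (u * x * v).left = u.left * u.right.act x.left * (u.right * x.right).act v.left := rfl
  have h2 : (u * x * v).right⁻¹ = v.right⁻¹ * (x.right⁻¹ * u.right⁻¹) := by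
    rw [SemidirectProduct.mul_right, SemidirectProduct.mul_right, mul_inv_rev, mul_inv_rev]
  filter_upwards [hu.ae (AEEqFun.coeFn_mul (u.left * u.right.act x.left)
      ((u.right * x.right).act v.left)),
    hu.ae (AEEqFun.coeFn_mul u.left (u.right.act x.left)), hu.ae (u.right.act_ae x.left),
    hu.ae ((u.right * x.right).act_ae v.left), u.right.inv_apply_ae,
    hu.ae (AutΩ.mul_ae v.right⁻¹ (x.right⁻¹ * u.right⁻¹)),
    hu.ae (AutΩ.mul_ae x.right⁻¹ u.right⁻¹)] with ω h3 h4 h5 h6 h7 h8 h9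
  constructor
  · rw [h1, h3, Pi.mul_apply, h4, Pi.mul_apply, h5, h6, h7, mul_inv_rev, h9, h7]
  · rw [h2, h8, h9, h7]

end Wreath

/-- Measurable choice of factorizations `g' = a g b` with `a, b` in an open set. -/
theorem exists_measurable_factor {G : Type*} [Group G] [TopologicalSpace G] [IsTopologicalGroup G]
    [PolishSpace G] [MeasurableSpace G] [BorelSpace G] {V : Set G} (hV : IsOpen V)
    (hV1 : (1 : G) ∈ V) (g g' : Ω → G) (hg : Measurable g) (hg' : Measurable g') :
    ∃ a : Ω → G, Measurable a ∧ (∀ ω, a ω ∈ V) ∧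
      ∀ ω, (∃ c ∈ V, ∃ b ∈ V, g' ω = c * g ω * b) → (g ω)⁻¹ * (a ω)⁻¹ * g' ω ∈ V := by
  classical
  let d := TopologicalSpace.denseSeq G
  -- Only `a` has to be chosen, since `b = g⁻¹ a⁻¹ g'`. The admissible `a` form an open set, which
  -- meets the dense sequence as soon as it is nonempty; the first admissible index depends
  -- measurably on `ω`.
  let Q : ℕ → Ω → Prop := fun n ω => d n ∈ V ∧ (g ω)⁻¹ * (d n)⁻¹ * g' ω ∈ V
  have hQ : ∀ n, MeasurableSet {ω | Q n ω} := fun n =>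
    (MeasurableSet.const _).inter (((hg.inv.mul_const _).mul hg') hV.measurableSet)
  have hQ' : MeasurableSet {ω | ∀ m, ¬ Q m ω} := by
    have : {ω | ∀ m, ¬ Q m ω} = ⋂ m, {ω | Q m ω}ᶜ := by ext; simp
    rw [this]
    exact MeasurableSet.iInter fun m => (hQ m).compl
  have hex : ∀ ω, ∃ n, Q n ω ∨ ∀ m, ¬ Q m ω := by
    intro ω
    by_cases h : ∃ n, Q n ω
    · exact h.imp fun _ => Or.inl
    · exact ⟨0, Or.inr (not_exists.1 h)⟩
  have hm : Measurable fun ω => Nat.find (hex ω) := measurable_find hex fun n =>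
    (hQ n).union hQ'
  -- The fallback `1 ∈ V` keeps `a` inside `V` even where no factorization exists.
  let e : ℕ → G := fun n => if d n ∈ V then d n else 1
  refine ⟨fun ω => e (Nat.find (hex ω)), (measurable_from_top (f := e)).comp hm, fun ω => ?_, fun ω => ?_⟩
  · simp only [e]
    split_ifs with h
    exacts [h, hV1]
  · rintro ⟨c, hc, b, hb, h⟩
    have hopen : IsOpen (V ∩ (fun a => (g ω)⁻¹ * a⁻¹ * g' ω) ⁻¹' V) :=
      hV.inter (hV.preimage (by fun_prop))
    have hne : (V ∩ (fun a => (g ω)⁻¹ * a⁻¹ * g' ω) ⁻¹' V).Nonempty :=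
      ⟨c, hc, by simp only [mem_preimage, h]; convert hb using 1; group⟩
    obtain ⟨_, ha, n, rfl⟩ := (TopologicalSpace.denseRange_denseSeq G).exists_mem_open hopen hne |>
      fun ⟨n, hn⟩ => (⟨d n, hn, n, rfl⟩ : ∃ a, a ∈ _ ∧ ∃ n, d n = a)
    rcases Nat.find_spec (hex ω) with h1 | h1
    · simp only [e, if_pos h1.1]
      exact h1.2
    · exact absurd ha (h1 n)

section Wreath

variable {G : Type*} [Group G] [TopologicalSpace G] [IsTopologicalGroup G] [PolishSpace G]

-- The automorphism is `s = u.right`. By `mul_mul_ae`, at `u ω` the three coordinates are those of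
-- `x` at `ω` moved by `u`, by `u` and `v`, and by `v⁻¹`. The bounds are uniform in `x` because
-- `x.right⁻¹` preserves the measure.
open Markov in
theorem exists_nhds_orbitVar_mul_mul {E : Set ((Ω × RoelckeCompletion G × Ω) ×
    Ω × RoelckeCompletion G × Ω)} (hE : E ∈ uniformity (Ω × RoelckeCompletion G × Ω)) {ε : ℝ}
    (hε : 0 < ε) : ∃ U ∈ 𝓝 (1 : Wreath G), ∀ u ∈ U, ∀ v ∈ U, ∀ x : Wreath G, ∃ s : AutΩ,
      volume {ω : Ω | (orbitVar (roelckeBase G) x ω,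
        orbitVar (roelckeBase G) (u * x * v) (s.toFun ω)) ∉ E} ≤ ENNReal.ofReal ε := by
  obtain ⟨δ, hδ, EK, hEK, hE⟩ := exists_entourage_of_mem_uniformity hE
  obtain ⟨V, hV, hVE⟩ := exists_nhds_forall_mul_mul_mem hEK
  -- There are four exceptional sets, two for `u` and two for `v`.
  have hη : 0 < min δ (ε / 4) := by positivity
  have hηε : ENNReal.ofReal (min δ (ε / 4)) ≤ ENNReal.ofReal (ε / 4) :=
    ENNReal.ofReal_le_ofReal (min_le_right _ _)
  refine ⟨_, Wreath.eventually_small hV hη, fun u ⟨hu1, hu2⟩ v ⟨hv1, hv2⟩ x => ⟨u.right, ?_⟩⟩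
  rw [← AutΩ.measure_dist_inv] at hv2
  calc _ ≤ volume (({ω : Ω | min δ (ε / 4) ≤ dist (u.right.toFun ω) ω} ∪
        u.right.toFun ⁻¹' {ω | u.left ω ∉ V}) ∪ (x.right⁻¹.toFun ⁻¹' {ω | v.left ω ∉ V} ∪
        x.right⁻¹.toFun ⁻¹' {ω | min δ (ε / 4) ≤ dist (v.right⁻¹.toFun ω) ω})) := by
        refine measure_mono_ae ?_
        filter_upwards [Wreath.mul_mul_ae u x v] with ω h (hω : (_, _) ∉ E)
        by_contra hn
        change ¬ ((_ ∨ _) ∨ (_ ∨ _)) at hn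
        push Not at hn
        obtain ⟨⟨h1, h2⟩, h3, h4⟩ := hn
        have h1 : ¬ (min δ (ε / 4) ≤ dist (u.right.toFun ω) ω) := h1
        have h2 : ¬ (u.left (u.right.toFun ω) ∉ V) := h2
        have h3 : ¬ (v.left (x.right⁻¹.toFun ω) ∉ V) := h3
        have h4 : ¬ (min δ (ε / 4) ≤
          dist (v.right⁻¹.toFun (x.right⁻¹.toFun ω)) (x.right⁻¹.toFun ω)) := h4
        refine hω (hE _ _ _ _ _ _ ?_ ?_ ?_)
        · rw [dist_comm]
          exact (not_le.1 h1).trans_le (min_le_left _ _)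
        · rw [smul_roelckeBase, smul_roelckeBase, h.1]
          exact hVE _ _ (not_not.1 h2) _ (not_not.1 h3)
        · rw [h.2, dist_comm]
          exact (not_le.1 h4).trans_le (min_le_left _ _)
    _ ≤ (ENNReal.ofReal (ε / 4) + ENNReal.ofReal (ε / 4)) +
        (ENNReal.ofReal (ε / 4) + ENNReal.ofReal (ε / 4)) := by
        refine (measure_union_le _ _).trans (add_le_add ((measure_union_le _ _).trans
          (add_le_add (hu2.trans hηε) ((AutΩ.measure_preimage_le _ _).trans (hu1.trans hηε))))
          ((measure_union_le _ _).trans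
          (add_le_add ((AutΩ.measure_preimage_le _ _).trans (hv1.trans hηε)) ((AutΩ.measure_preimage_le _ _).trans (hv2.trans hηε)))))
    _ = ENNReal.ofReal ε := by
        rw [← ENNReal.ofReal_add (by positivity) (by positivity),
          ← ENNReal.ofReal_add (by positivity) (by positivity)]
        congr 1; ring

-- The first coordinate says that `s` is near `1`, the second that `y(s ω) = a x(ω) b` with `a, b ∈
-- V` for most `ω`, the third that `y.right⁻¹ s` is near `x.right⁻¹`. The first two give `u = (s.act
-- A, s)`, and the last two show that the remaining factor `v` is small.
open Markov in
theorem exists_uniformity_eq_mul_mul_of_orbitVar {U : Set (Wreath G)} (hU : U ∈ 𝓝 (1 : Wreath G)) :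
    ∃ E ∈ uniformity (Ω × RoelckeCompletion G × Ω), ∃ ε : ℝ, 0 < ε ∧
      ∀ (x y : Wreath G) (s : AutΩ), volume {ω : Ω | (orbitVar (roelckeBase G) x ω,
        orbitVar (roelckeBase G) y (s.toFun ω)) ∉ E} ≤ ENNReal.ofReal ε →
      ∃ u ∈ U, ∃ v ∈ U, y = u * x * v := by
  let : MeasurableSpace G := borel G
  have : BorelSpace G := ⟨rfl⟩
  obtain ⟨V, hV, hVo, ε, hε, hVU⟩ := Wreath.exists_small_subset hU
  obtain ⟨EK, hEK, hV'⟩ := exists_uniformity_forall_eq_mul_mul hV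
  refine ⟨_, mem_uniformity_triple hε hEK, ε, hε, fun x y s h => ?_⟩
  have hs := s.measurePreserving
  have hxm := x.left.stronglyMeasurable.measurable
  have hym := y.left.stronglyMeasurable.measurable.comp hs.measurable
  obtain ⟨a, ham, haV, ha⟩ := exists_measurable_factor hVo (mem_of_mem_nhds hV) x.left
    (fun ω => y.left (s.toFun ω)) hxm hym
  let A : L0 G := AEEqFun.mk a ham.aestronglyMeasurable
  have hA : ∀ᵐ ω : Ω, A ω = a ω := AEEqFun.coeFn_mk _ _
  let B : L0 G := x.left⁻¹ * A⁻¹ * s⁻¹.act y.left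
  have hB : ∀ᵐ ω : Ω, B ω = (x.left ω)⁻¹ * (a ω)⁻¹ * y.left (s.toFun ω) := by
    filter_upwards [AEEqFun.coeFn_mul (x.left⁻¹ * A⁻¹) (s⁻¹.act y.left),
      AEEqFun.coeFn_mul x.left⁻¹ A⁻¹, AEEqFun.coeFn_inv x.left, AEEqFun.coeFn_inv A, hA,
      s⁻¹.act_ae y.left] with ω h1 h2 h3 h4 h5 h6
    simp only [B]
    rw [h1, Pi.mul_apply, h2, Pi.mul_apply, h3, h4, Pi.inv_apply, Pi.inv_apply, h5, h6, inv_inv]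
  have hAB : A * x.left * B = s⁻¹.act y.left := by
    simp only [B]; group
  -- The second factor is forced by `y = u x v`. Since `A` takes values in `V` almost everywhere,
  -- the left component of `u` costs nothing.
  refine ⟨⟨s.act A, s⟩, hVU _ ?_ ?_, ⟨x.right⁻¹.act B, x.right⁻¹ * (s⁻¹ * y.right)⟩,
    hVU _ ?_ ?_, ?_⟩
  · refine le_of_eq_of_le ?_ zero_le
    change ∀ᵐ ω : Ω, s.act A ω ∈ V
    filter_upwards [s.act_ae A, s⁻¹.measurePreserving.quasiMeasurePreserving.ae hA] with ω h1 h2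
    rw [h1, h2]
    exact haV _
  · refine (measure_mono (ofPred_subset_ofPred.2 fun ω hω h' => ?_)).trans h
    have h1 : dist ω (s.toFun ω) < ε := h'.1
    rw [dist_comm] at h1
    exact absurd hω (not_le.2 h1)
  · refine (le_trans ?_ (AutΩ.measure_preimage_le x.right {ω | B ω ∉ V})).trans (le_trans ?_ h)
    · refine measure_mono_ae ?_
      filter_upwards [x.right⁻¹.act_ae B] with ω h1 (h2 : x.right⁻¹.act B ω ∉ V)
      rw [h1, inv_inv] at h2
      exact h2
    · refine measure_mono_ae ?_
      filter_upwards [hB] with ω h1 (h2 : B ω ∉ V)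
      rw [h1] at h2
      intro h'
      refine h2 (ha ω (hV' _ _ ?_))
      have h3 : (x.left ω • roelckeBase G, y.left (s.toFun ω) • roelckeBase G) ∈ EK := h'.2.1
      rwa [smul_roelckeBase, smul_roelckeBase] at h3
  · rw [← AutΩ.measure_dist_inv]
    refine (le_trans ?_ (AutΩ.measure_preimage_le x.right {ω | ε ≤ dist (y.right⁻¹.toFun (s.toFun ω))
      (x.right⁻¹.toFun ω)})).trans (le_trans ?_ h)
    · refine measure_mono_ae ?_
      filter_upwards [AutΩ.mul_ae (y.right⁻¹ * s) x.right, x.right.inv_apply_ae,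
        x.right.measurePreserving.quasiMeasurePreserving.ae (AutΩ.mul_ae y.right⁻¹ s)]
        with ω h1 h2 h3 (h4 : ε ≤ dist ((x.right⁻¹ * (s⁻¹ * y.right))⁻¹.toFun ω) ω)
      have h5 : (x.right⁻¹ * (s⁻¹ * y.right))⁻¹ = y.right⁻¹ * s * x.right := by group
      rw [h5, h1, h3] at h4
      change ε ≤ dist (y.right⁻¹.toFun (s.toFun (x.right.toFun ω)))
        (x.right⁻¹.toFun (x.right.toFun ω))
      rwa [h2]
    · refine measure_mono (ofPred_subset_ofPred.2 fun ω hω h' => ?_)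
      have h1 : dist (x.right⁻¹.toFun ω) (y.right⁻¹.toFun (s.toFun ω)) < ε := h'.2.2
      rw [dist_comm] at h1
      exact absurd hω (not_le.2 h1)
  · refine SemidirectProduct.ext ?_ ?_
    · change y.left = s.act A * s.act x.left * (s * x.right).act (x.right⁻¹.act B)
      rw [← AutΩ.mul_act, mul_inv_cancel_right]
      have h1 : ∀ f g : L0 G, s.act f * s.act g = s.act (f * g) := fun f g =>
        ((autHom G s).map_mul f g).symm
      rw [h1, h1, hAB, ← AutΩ.mul_act, mul_inv_cancel, AutΩ.one_act]
    · change y.right = s * x.right * (x.right⁻¹ * (s⁻¹ * y.right))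
      group

end Wreath

/-! ### Density of the orbit -/

/-- `Aut(Ω)` is dense in `End(Ω)`. -/
theorem exists_aut_close (s : Ω → Ω) (hs : MeasurePreserving s (volume : Measure Ω) volume)
    {δ : ℝ} (hδ : 0 < δ) {ε : ℝ} (hε : 0 < ε) :
    ∃ σ : AutΩ, volume {ω : Ω | ¬ dist (s ω) (σ.toFun ω) < δ} ≤ ENNReal.ofReal ε := by
  let l : ProbabilityMeasure Ω := ⟨volume, inferInstance⟩
  obtain ⟨N, hN, h⟩ := exists_nhds_forall_exists_aut l (Metric.dist_mem_uniformity (α := Ω) hδ) hε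
  -- Both `s` and the identity have law `volume`, so `l` serves for both.
  exact h s id hs.measurable measurable_id l (mem_of_mem_nhds hN) l (mem_of_mem_nhds hN)
    hs.map_eq.symm Measure.map_id.symm

section Wreath

theorem denseRange_toRoelcke {G : Type*} [Group G] [TopologicalSpace G] [IsTopologicalGroup G] :
    DenseRange (toRoelcke G) :=
  UniformSpace.Completion.denseRange_coe (α := WithRoelcke G)

variable {G : Type*} [Group G] [TopologicalSpace G] [IsTopologicalGroup G] [PolishSpace G]

instance instIsCountablyGeneratedUniformity :
    (uniformity (RoelckeCompletion G)).IsCountablyGenerated := by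
  let := UniformSpace.pseudoMetricSpace (WithRoelcke G)
  exact EMetric.instIsCountablyGeneratedUniformity (α := RoelckeCompletion G)

/-- Random variables with values in `R(G)` are approximated by those with values in `G`. -/
theorem exists_L0_toRoelcke_close (k : Ω → RoelckeCompletion G) (hk : Measurable k)
    {E : Set (RoelckeCompletion G × RoelckeCompletion G)}
    (hE : E ∈ uniformity (RoelckeCompletion G)) :
    ∃ g : L0 G, ∀ᵐ ω : Ω, (k ω, toRoelcke G (g ω)) ∈ E := by
  classical
  let : MeasurableSpace G := borel G
  have : BorelSpace G := ⟨rfl⟩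
  obtain ⟨E', ⟨hE', hE'o⟩, hEE'⟩ := uniformity_hasBasis_open.mem_iff.1 hE
  let d := TopologicalSpace.denseSeq G
  have hcont : Continuous (toRoelcke G) := by
    have h : Continuous fun g : G => g • roelckeBase G := continuous_id.smul continuous_const
    exact h.congr smul_roelckeBase
  have hd : DenseRange (toRoelcke G ∘ d) :=
    denseRange_toRoelcke.comp (TopologicalSpace.denseRange_denseSeq G) hcont
  have hopen : ∀ c, IsOpen {z | (z, c) ∈ E'} := fun c =>
    hE'o.preimage (continuous_id.prodMk continuous_const)
  have hex : ∀ ω, ∃ n, (k ω, toRoelcke G (d n)) ∈ E' := fun ω =>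
    hd.exists_mem_open (s := {z | (k ω, z) ∈ E'})
      (hE'o.preimage (continuous_const.prodMk continuous_id)) ⟨k ω, refl_mem_uniformity hE'⟩
  have hm : Measurable fun ω => d (Nat.find (hex ω)) := (measurable_from_top (f := d)).comp
    (measurable_find hex fun n => hk (hopen _).measurableSet)
  refine ⟨AEEqFun.mk _ hm.aestronglyMeasurable, ?_⟩
  filter_upwards [AEEqFun.coeFn_mk (μ := (volume : Measure Ω)) _ hm.aestronglyMeasurable] with ω h
  rw [h]
  exact hEE' (Nat.find_spec (hex ω))

namespace Markov

/-- Approximate the outer coordinates by automorphisms `σ`, `ρ` and the middle one by a `G`-valued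
`g`. -/
theorem exists_orbitVar_close (p : Ω → Ω × RoelckeCompletion G × Ω)
    (h1 : MeasurePreserving (fun ω => (p ω).1) (volume : Measure Ω) volume)
    (h2 : Measurable fun ω => (p ω).2.1)
    (h3 : MeasurePreserving (fun ω => (p ω).2.2) (volume : Measure Ω) volume)
    {E : Set ((Ω × RoelckeCompletion G × Ω) × Ω × RoelckeCompletion G × Ω)}
    (hE : E ∈ uniformity (Ω × RoelckeCompletion G × Ω)) {ε : ℝ} (hε : 0 < ε) :
    ∃ (x : Wreath G) (σ : AutΩ), volume {ω : Ω | (p ω, orbitVar (roelckeBase G) x (σ.toFun ω)) ∉ E}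
      ≤ ENNReal.ofReal ε := by
  obtain ⟨δ, hδ, EK, hEK, hE⟩ := exists_entourage_of_mem_uniformity hE
  obtain ⟨g, hg⟩ := exists_L0_toRoelcke_close _ h2 hEK
  obtain ⟨σ, hσ⟩ := exists_aut_close _ h1 hδ (half_pos hε)
  obtain ⟨ρ, hρ⟩ := exists_aut_close _ h3 hδ (half_pos hε)
  -- Reparametrized by `σ⁻¹`, the triple `(σ, g k₀, ρ)` becomes `(1, (g ∘ σ⁻¹) k₀, ρ σ⁻¹)`, and the
  -- third entry must be `x.right⁻¹`.
  refine ⟨⟨σ.act g, σ * ρ⁻¹⟩, σ, ?_⟩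
  calc _ ≤ volume ({ω : Ω | ¬ dist (p ω).1 (σ.toFun ω) < δ} ∪
        {ω : Ω | ¬ dist (p ω).2.2 (ρ.toFun ω) < δ}) := by
        refine measure_mono_ae ?_
        have hq := σ.measurePreserving.quasiMeasurePreserving
        filter_upwards [hg, σ.inv_apply_ae, hq.ae (σ.act_ae g), hq.ae (AutΩ.mul_ae ρ σ⁻¹)]
          with ω h4 h5 h6 h7 (h8 : (_, _) ∉ E)
        by_contra hn
        change ¬ (_ ∨ _) at hn
        obtain ⟨h9, h10⟩ := not_or.1 hn
        refine h8 (hE _ _ _ _ _ _ (not_not.1 h9) ?_ ?_)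
        · rw [smul_roelckeBase, h6, h5]
          exact h4
        · change dist (p ω).2.2 ((σ * ρ⁻¹)⁻¹.toFun (σ.toFun ω)) < δ
          rw [mul_inv_rev, inv_inv, h7, h5]
          exact not_not.1 h10
    _ ≤ ENNReal.ofReal (ε / 2) + ENNReal.ofReal (ε / 2) :=
        (measure_union_le _ _).trans (add_le_add hσ hρ)
    _ = ENNReal.ofReal ε := by
        rw [← ENNReal.ofReal_add (by positivity) (by positivity), add_halves]

variable [CompactSpace (RoelckeCompletion G)]

/-- Expectations are uniformly continuous with respect to closeness in measure. -/
theorem exists_entourage_integral_close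
    (f : BoundedContinuousFunction (Ω × RoelckeCompletion G × Ω) ℝ) {ε : ℝ} (hε : 0 < ε) :
    ∃ E ∈ uniformity (Ω × RoelckeCompletion G × Ω), ∃ η : ℝ, 0 < η ∧
      ∀ p q : Ω → Ω × RoelckeCompletion G × Ω, Measurable p → Measurable q →
      volume {ω : Ω | (p ω, q ω) ∉ E} ≤ ENNReal.ofReal η →
      |(∫ ω, f (p ω)) - ∫ ω, f (q ω)| < ε := by
  have hf := CompactSpace.uniformContinuous_of_continuous f.continuous
  have hE := hf (Metric.dist_mem_uniformity (half_pos hε))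
  -- This makes `2 ‖f‖ η < ε / 2`; the `+ 1` allows for `f = 0`.
  have hη : 0 < ε / (4 * (‖f‖ + 1)) := by positivity
  refine ⟨_, hE, ε / (4 * (‖f‖ + 1)), hη, fun p q hp hq h => ?_⟩
  refine (abs_integral_sub_integral_le f (half_pos hε).le hη.le ?_ p q hp hq h).trans_lt ?_
  · intro a b hab
    have hab' : dist (f a) (f b) < ε / 2 := hab
    rw [Real.dist_eq] at hab'
    exact hab'.le
  · have h1 : 2 * ‖f‖ * (ε / (4 * (‖f‖ + 1))) = ε / 2 * (‖f‖ / (‖f‖ + 1)) := by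
      field_simp; ring
    have h2 : ‖f‖ / (‖f‖ + 1) < 1 := (div_lt_one (by positivity)).2 (lt_add_one _)
    rw [h1]
    nlinarith

/-- Any probability measure on a nonempty standard Borel space is the law of a variable `p` on `Ω`.
The marginal conditions make the outer coordinates of `p` measure preserving, so
`exists_orbitVar_close` applies; closeness in measure gives convergence of laws. -/
theorem dense_orbit_base :
    DenseRange fun x : Wreath G => (x • base (roelckeBase G) : Markov (RoelckeCompletion G)) := by
  intro l
  have : Nonempty (RoelckeCompletion G) := ⟨roelckeBase G⟩
  obtain ⟨p, hp, hpl⟩ := l.toMeasure.exists_measurable_map_eq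
  have hpm : MeasurePreserving p volume l.toMeasure := ⟨hp, hpl⟩
  have h1 := l.measurePreserving_fst.comp hpm
  have h3 := l.measurePreserving_snd.comp hpm
  obtain ⟨E, hE⟩ := (uniformity (Ω × RoelckeCompletion G × Ω)).exists_antitone_basis
  have hx := fun n : ℕ => exists_orbitVar_close p h1 hp.snd.fst h3 (hE.mem n)
    (Nat.one_div_pos_of_nat (α := ℝ) (n := n))
  choose x σ hxσ using hx
  refine mem_closure_of_tendsto (f := fun n => x n • base (roelckeBase G)) (b := atTop) ?_
    (Eventually.of_forall fun n => mem_range_self (x n))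
  refine isInducing_integral.tendsto_nhds_iff.2 (tendsto_pi_nhds.2 fun f => ?_)
  refine Metric.tendsto_nhds.2 fun ε hε => ?_
  obtain ⟨E', hE', η, hη, h⟩ := exists_entourage_integral_close f hε
  obtain ⟨N, -, hN⟩ := hE.toHasBasis.mem_iff.1 hE'
  filter_upwards [eventually_ge_atTop N,
    tendsto_one_div_add_atTop_nhds_zero_nat.eventually (gt_mem_nhds hη)] with n hn hnη
  have h4 : ∫ z, f z ∂l.toMeasure = ∫ ω, f (p ω) := by
    rw [← hpl, integral_map hp.aemeasurable f.continuous.aestronglyMeasurable]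
  simp only [Function.comp_apply]
  rw [dist_comm, Real.dist_eq, h4, integral_smul_base _ _ (σ n)]
  refine h p _ hp ((measurable_orbitVar _ _).comp (σ n).measurePreserving.measurable) ?_
  refine (measure_mono (ofPred_subset_ofPred.2 fun ω hω h' => hω ?_)).trans
    ((hxσ n).trans (ENNReal.ofReal_le_ofReal hnη.le))
  exact hN (hE.antitone hn h')

/-! ### The orbit map as a completion, and the homeomorphism -/

/-- The orbit map of the base point of `𝓜(Ω, R(G))`. -/
def orbitMap (x : WithRoelcke (Wreath G)) : Markov (RoelckeCompletion G) :=
  (show Wreath G from x) • base (roelckeBase G)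

theorem uniformContinuous_integral_orbitMap
    (f : BoundedContinuousFunction (Ω × RoelckeCompletion G × Ω) ℝ) :
    UniformContinuous fun x : WithRoelcke (Wreath G) => ∫ p, f p ∂(orbitMap x).toMeasure := by
  refine (Filter.HasBasis.uniformContinuous_iff (α := WithRoelcke (Wreath G))
    (WithRoelcke.hasBasis_uniformity (Wreath G)) Metric.uniformity_basis_dist).2 fun ε hε => ?_
  obtain ⟨E, hE, η, hη, h⟩ := exists_entourage_integral_close f hε
  obtain ⟨U, hU, hUE⟩ := exists_nhds_orbitVar_mul_mul hE hη
  refine ⟨U, hU, fun x y hxy => ?_⟩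
  obtain ⟨u, hu, v, hv, huv⟩ := hxy
  obtain ⟨s, hs⟩ := hUE u hu v hv x
  have h1 := integral_smul_base (roelckeBase G) (show Wreath G from x) 1 f
  have h2 := integral_smul_base (roelckeBase G) (u * (show Wreath G from x) * v) s f
  have huv' : y = u * (show Wreath G from x) * v := huv
  have h3 : (∫ ω, f (orbitVar (roelckeBase G) x ((1 : AutΩ).toFun ω))) =
      ∫ ω, f (orbitVar (roelckeBase G) x ω) := by
    refine integral_congr_ae ?_
    filter_upwards [AutΩ.one_ae] with ω h4
    rw [h4]
  change |(∫ p, f p ∂_) - ∫ p, f p ∂_| < ε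
  rw [orbitMap, orbitMap, huv', h1, h3, h2]
  exact h _ _ (measurable_orbitVar _ _)
    ((measurable_orbitVar _ _).comp s.measurePreserving.measurable) hs

theorem exists_uniformity_forall_orbitMap {U : Set (Wreath G)} (hU : U ∈ 𝓝 (1 : Wreath G)) :
    ∃ E ∈ @uniformity (Markov (RoelckeCompletion G)) uniformSpace, ∀ x y : Wreath G,
      (orbitMap x, orbitMap y) ∈ E → ∃ u ∈ U, ∃ v ∈ U, y = u * x * v := by
  let : UniformSpace (Markov (RoelckeCompletion G)) := uniformSpace
  obtain ⟨E, hE, ε, hε, h⟩ := exists_uniformity_eq_mul_mul_of_orbitVar hU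
  -- The neighbourhood in `exists_nhds_forall_exists_aut` depends on the law `l`; a Lebesgue
  -- entourage of the compact space `𝓜(Ω, R(G))` removes this dependence.
  choose N hN hNE using fun l : Markov (RoelckeCompletion G) =>
    exists_nhds_forall_exists_aut l.1 hE hε
  obtain ⟨V, hV, hVN⟩ := lebesgue_number_lemma_nhds
    (isCompact_univ (X := Markov (RoelckeCompletion G)))
    fun l _ => continuous_subtype_val.continuousAt.preimage_mem_nhds (hN l)
  refine ⟨V, hV, fun x y hxy => ?_⟩
  obtain ⟨l, hl⟩ := hVN (orbitMap x) (mem_univ _)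
  obtain ⟨s, hs⟩ := hNE l (orbitVar (roelckeBase G) x) (orbitVar (roelckeBase G) y)
    (measurable_orbitVar _ _) (measurable_orbitVar _ _) (orbitMap x).1
    (hl (UniformSpace.mem_ball_self _ hV)) (orbitMap y).1 (hl hxy)
    (toMeasure_smul_base _ _) (toMeasure_smul_base _ _)
  exact h x y s hs

/-- The orbit map of the base point of `𝓜(Ω, R(G))` induces the Roelcke uniformity of
`G ≀ Ω`. -/
theorem isUniformInducing_orbitMap :
    @IsUniformInducing (WithRoelcke (Wreath G)) (Markov (RoelckeCompletion G)) _ uniformSpace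
      orbitMap := by
  let : UniformSpace (Markov (RoelckeCompletion G)) := uniformSpace
  refine isUniformInducing_iff'.2 ⟨?_, ?_⟩
  · have h : UniformContinuous fun (x : WithRoelcke (Wreath G))
        (f : BoundedContinuousFunction (Ω × RoelckeCompletion G × Ω) ℝ) =>
        ∫ p, f p ∂(orbitMap x).toMeasure :=
      uniformContinuous_pi.2 uniformContinuous_integral_orbitMap
    exact (Embedding.to_isUniformEmbedding _ (isEmbedding_integral
      (K := RoelckeCompletion G))).isUniformInducing.uniformContinuous_iff.2 h
  · refine (WithRoelcke.hasBasis_uniformity (Wreath G)).ge_iff.2 fun U hU => ?_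
    obtain ⟨E, hE, h⟩ := exists_uniformity_forall_orbitMap hU
    exact mem_comap.2 ⟨E, hE, fun p hp => h p.1 p.2 hp⟩

/-- `𝓜(Ω, R(G))` is a completion of `G ≀ Ω` with its Roelcke uniformity. -/
def abstractCompletion : AbstractCompletion (WithRoelcke (Wreath G)) :=
  letI : UniformSpace (Markov (RoelckeCompletion G)) := uniformSpace
  { space := Markov (RoelckeCompletion G)
    coe := orbitMap
    uniformStruct := inferInstance
    complete := inferInstance
    separation := inferInstance
    isUniformInducing := isUniformInducing_orbitMap
    dense := dense_orbit_base }

/-- The homeomorphism between the Roelcke compactification of `G ≀ Ω` and `𝓜(Ω, R(G))`. -/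
def roelckeHomeomorph : RoelckeCompletion (Wreath G) ≃ₜ Markov (RoelckeCompletion G) :=
  let pkg := UniformSpace.Completion.cPkg (α := WithRoelcke (Wreath G))
  letI := pkg.uniformStruct
  letI := (abstractCompletion (G := G)).uniformStruct
  { toEquiv := (pkg.compareEquiv abstractCompletion).toEquiv
    continuous_toFun := (pkg.compareEquiv abstractCompletion).continuous
    continuous_invFun := (pkg.compareEquiv abstractCompletion).symm.continuous }

theorem roelckeHomeomorph_toRoelcke (x : Wreath G) :
    roelckeHomeomorph (toRoelcke (Wreath G) x) = x • base (roelckeBase G) :=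
  (UniformSpace.Completion.cPkg (α := WithRoelcke (Wreath G))).compare_coe
    (abstractCompletion (G := G)) x

/-- Both sides are continuous in `z` and agree on the dense image of the group. Only continuity of
each single translation is needed, so the joint continuity below can rest on this. -/
theorem roelckeHomeomorph_smul (x : Wreath G) (z : RoelckeCompletion (Wreath G)) :
    roelckeHomeomorph (x • z) = x • roelckeHomeomorph z := by
  have h1 : Continuous fun z : RoelckeCompletion (Wreath G) => roelckeHomeomorph (x • z) :=
    roelckeHomeomorph.continuous.comp (continuous_const_smul x)
  have h2 : Continuous fun z : RoelckeCompletion (Wreath G) => x • roelckeHomeomorph z :=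
    (continuous_const_smul_wreath x).comp roelckeHomeomorph.continuous
  refine congrFun (DenseRange.equalizer (denseRange_toRoelcke (G := Wreath G)) h1 h2 ?_) z
  funext y
  have h3 : x • toRoelcke (Wreath G) y = toRoelcke (Wreath G) (x * y) := by
    rw [← smul_roelckeBase, ← smul_roelckeBase, mul_smul]
  simp only [Function.comp_apply]
  rw [h3, roelckeHomeomorph_toRoelcke, roelckeHomeomorph_toRoelcke, mul_smul]

theorem roelckeHomeomorph_roelckeBase :
    roelckeHomeomorph (roelckeBase (Wreath G)) = base (roelckeBase G) :=
  (roelckeHomeomorph_toRoelcke 1).trans (one_smul _ _)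

/-- Joint continuity is transported from the Roelcke completion, where it holds for every
topological group. -/
instance instContinuousSMul : ContinuousSMul (Wreath G) (Markov (RoelckeCompletion G)) where
  continuous_smul := by
    have h : Continuous fun p : Wreath G × Markov (RoelckeCompletion G) =>
        roelckeHomeomorph (p.1 • roelckeHomeomorph.symm p.2) :=
      roelckeHomeomorph.continuous.comp
        (continuous_fst.smul (roelckeHomeomorph.symm.continuous.comp continuous_snd))
    refine h.congr fun p => ?_
    rw [roelckeHomeomorph_smul, Homeomorph.apply_symm_apply]

end Markov

end Wreath

end
end Randomization

/-- For a Roelcke precompact Polish group `G`, the Roelcke compactification of `G ≀ Ω` and the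
Markov randomization of the Roelcke compactification of `G` are isomorphic compactifications of
`G ≀ Ω`: there is an equivariant homeomorphism that respects the distinguished points. -/
theorem mainTheorem3 (G : Type*) [Group G] [TopologicalSpace G] [IsTopologicalGroup G]
    [PolishSpace G] (hG : Randomization.IsRoelckePrecompact G) :
    Randomization.IsCompactification (Randomization.Wreath G)
      (Randomization.RoelckeCompletion (Randomization.Wreath G))
      (Randomization.roelckeBase (Randomization.Wreath G)) ∧
    Randomization.IsCompactification (Randomization.Wreath G)
      (Randomization.Markov (Randomization.RoelckeCompletion G))
      (Randomization.Markov.base (Randomization.roelckeBase G)) ∧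
    ∃ Φ : Randomization.RoelckeCompletion (Randomization.Wreath G) ≃ₜ
        Randomization.Markov (Randomization.RoelckeCompletion G),
      (∀ (x : Randomization.Wreath G)
        (z : Randomization.RoelckeCompletion (Randomization.Wreath G)), Φ (x • z) = x • Φ z) ∧
      Φ (Randomization.roelckeBase (Randomization.Wreath G)) =
        Randomization.Markov.base (Randomization.roelckeBase G) := by
  have : CompactSpace (Randomization.RoelckeCompletion G) := hG
  refine ⟨⟨?_, inferInstance, inferInstance, ?_⟩, ⟨inferInstance, inferInstance, inferInstance, ?_⟩,
    Randomization.Markov.roelckeHomeomorph, Randomization.Markov.roelckeHomeomorph_smul,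
    Randomization.Markov.roelckeHomeomorph_roelckeBase⟩
  -- Roelcke precompactness of `G ≀ Ω` is a consequence of the homeomorphism.
  · exact Randomization.Markov.roelckeHomeomorph.symm.compactSpace
  · have h := Randomization.denseRange_toRoelcke (G := Randomization.Wreath G)
    rwa [← funext Randomization.smul_roelckeBase] at h
  · exact Randomization.Markov.dense_orbit_base
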